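/- Let $\mathbb T=\mathbb R/2\pi\mathbb Z$ and, for $\rho\ge 0$, let $H^\rho$ be the Sobolev space of real-valued functions $u$ of zero mean value on $\mathbb T$, with norm $\|u\|_{H^\rho}=\big(\sum_{n\in\mathbb Z}(1+n^2)^\rho|\hat u(n)|^2\big)^{1/2}$, and $B^\rho(r)=\{u\in H^\rho:\|u\|_{H^\rho}<r\}$. Let $H$ be the Hilbert transform (the Fourier multiplier $-i\,\mathrm{sgn}(n)$) and, for $N\in\mathbb N$, let $\pi_N$ be the projector to the Fourier modes $|n|\le N$. Consider the Benjamin–Ono equation and its truncation $$\text{(BO)}\quad \partial_t u+H\partial_x^2u+u\,\partial_xu=0,\qquad\qquad \text{(BO}_N)\quad \partial_t u+H\partial_x^2u+\pi_N\big((\pi_Nu)\,\partial_x(\pi_Nu)\big)=0 .$$ For $\sigma>2$, $A\subset H^\sigma$ and $t\in\mathbb R$, let $\Phi_t(A)$ (respectively $\Phi^N_t(A)$) be the set of all $u(t)$, where $u\in C(I_t;H^\sigma)$ solves (BO) (respectively (BO$_N$)), in the sense of distributions in $x$, on the closed time interval $I_t$ with end points $0$ and $t$, and $u(0)\in A$.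 **Proposition.** For every $R>0$ there is $\bar t=\bar t(R)>0$ such that, for all real $s,\sigma$ with $2\le s<\sigma$ and for every $\varepsilon>0$, there exists $N_0\in\mathbb N$ with $$\Phi^N_t(A)\subset\Phi_t(A)+B^s(\varepsilon)\qquad\text{for all } N>N_0,\ \text{all } t\in(-\bar t,\bar t)\ \text{and all } A\subset B^\sigma(R).$$ In words, the truncated Benjamin–Ono flows converge to the Benjamin–Ono flow in $H^s$, uniformly on balls of $H^\sigma$, for short times. -/

import Mathlib

open MeasureTheory Filter Topology
open scoped Real Pointwise

noncomputable section

namespace BenjaminOno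

/-- The torus `ℝ / 2πℤ`. -/
abbrev Torus : Type := AddCircle (2 * π)

instance factTwoPiPos : Fact (0 < 2 * π) := ⟨Real.two_pi_pos⟩

/-- Complex-valued square integrable functions on the torus, for the normalised Lebesgue measure
`dx / 2π`. The real-valued functions are singled out in the definition of `Hs`. -/
abbrev L2 : Type := Lp ℂ 2 (AddCircle.haarAddCircle (T := 2 * π))

/-- The Fourier coefficient `û(n) = (1 / 2π) ∫ u(x) e^{-inx} dx`. -/
def coeff (u : L2) (n : ℤ) : ℂ := fourierCoeff (T := 2 * π) (u : Torus → ℂ) n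

/-- The Fourier multiplier with symbol `m`: `u ↦ ∑ₙ m(n) û(n) e^{inx}`, the series being taken in
`L²`. It is used only for functions `u` for which this series converges, that is, for which
`∑ₙ |m(n) û(n)|² < ∞`. -/
def multiplier (m : ℤ → ℂ) (u : L2) : L2 :=
  ∑' n : ℤ, (m n * coeff u n) • fourierLp (T := 2 * π) 2 n

/-- The derivative `∂ₓ`, of symbol `in`. -/
def dx (u : L2) : L2 := multiplier (fun n => Complex.I * (n : ℂ)) u

/-- The Hilbert transform `H`, of symbol `-i sgn(n)`, so that `(1 + iH) / 2` is the projection to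
the positive frequencies on functions of zero mean value. -/
def hilbert (u : L2) : L2 := multiplier (fun n => -Complex.I * (Int.sign n : ℂ)) u

/-- The symbol of the Dirichlet projector `π_N` to the frequencies `|n| ≤ N`. -/
def projSymbol (N : ℕ) (n : ℤ) : ℂ := if |n| ≤ (N : ℤ) then 1 else 0

/-- The Dirichlet projector `π_N`. -/
def proj (N : ℕ) (u : L2) : L2 := multiplier (projSymbol N) u

/-- The `n`-th Fourier coefficient of the (integrable) product `u v` of two `L²` functions. -/
def coeffMul (u v : L2) (n : ℤ) : ℂ :=
  fourierCoeff (T := 2 * π) (fun x : Torus => u x * v x) n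

/-- The Sobolev space `H^ρ` (`ρ ≥ 0`) of real-valued functions of zero mean value on the torus. -/
def Hs (ρ : ℝ) : Set L2 :=
  {u | (∀ᵐ x ∂(AddCircle.haarAddCircle (T := 2 * π)), (u x).im = 0) ∧ coeff u 0 = 0 ∧
    Summable fun n : ℤ => (1 + (n : ℝ) ^ 2) ^ ρ * ‖coeff u n‖ ^ 2}

/-- The Sobolev norm `‖u‖_{H^ρ} = (∑ₙ (1 + n²)^ρ |û(n)|²)^{1/2}`, for `u ∈ H^ρ`. -/
def sobolevNorm (ρ : ℝ) (u : L2) : ℝ :=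
  √(∑' n : ℤ, (1 + (n : ℝ) ^ 2) ^ ρ * ‖coeff u n‖ ^ 2)

/-- The open ball `B^ρ(r)` of `H^ρ` centred at the origin. -/
def sobolevBall (ρ r : ℝ) : Set L2 := {u | u ∈ Hs ρ ∧ sobolevNorm ρ u < r}

/-- `u ∈ C(I; H^ρ)`. -/
def ContinuousInHs (ρ : ℝ) (I : Set ℝ) (u : ℝ → L2) : Prop :=
  ∀ t ∈ I, u t ∈ Hs ρ ∧ Tendsto (fun τ => sobolevNorm ρ (u τ - u t)) (𝓝[I] t) (𝓝 0)

/-- `u ∈ C(I; H^ρ)` solves the Benjamin-Ono equation `∂ₜu + H∂ₓ²u + u∂ₓu = 0` on the time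
interval `I`. The equation is an equality of periodic distributions in `x`, that is, it holds for
each Fourier coefficient (`ρ ≥ 2`, so that all the terms are defined). -/
def SolvesBO (ρ : ℝ) (I : Set ℝ) (u : ℝ → L2) : Prop :=
  ContinuousInHs ρ I u ∧
  ∀ t ∈ I, ∀ n : ℤ, HasDerivWithinAt (fun τ => coeff (u τ) n)
    (-coeff (hilbert (dx (dx (u t)))) n - coeffMul (u t) (dx (u t)) n) I t

/-- `u ∈ C(I; H^ρ)` solves the truncated equation
`∂ₜu + H∂ₓ²u + π_N((π_N u) ∂ₓ(π_N u)) = 0` on the time interval `I`, in the same sense. -/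
def SolvesTruncatedBO (N : ℕ) (ρ : ℝ) (I : Set ℝ) (u : ℝ → L2) : Prop :=
  ContinuousInHs ρ I u ∧
  ∀ t ∈ I, ∀ n : ℤ, HasDerivWithinAt (fun τ => coeff (u τ) n)
    (-coeff (hilbert (dx (dx (u t)))) n
      - projSymbol N n * coeffMul (proj N (u t)) (dx (proj N (u t))) n) I t

/-- `Φ_t(A)`, for `A ⊆ H^ρ`: the values at time `t` of the solutions in `H^ρ` of the Benjamin-Ono
equation, on the closed time interval with end points `0` and `t`, whose value at time `0` is
in `A`. -/
def flowImage (ρ t : ℝ) (A : Set L2) : Set L2 :=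
  {f | ∃ u : ℝ → L2, SolvesBO ρ (Set.uIcc 0 t) u ∧ u 0 ∈ A ∧ u t = f}

/-- `Φ^N_t(A)`, for `A ⊆ H^ρ`: the same set for the truncated equation. -/
def truncatedFlowImage (N : ℕ) (ρ t : ℝ) (A : Set L2) : Set L2 :=
  {f | ∃ u : ℝ → L2, SolvesTruncatedBO N ρ (Set.uIcc 0 t) u ∧ u 0 ∈ A ∧ u t = f}

end BenjaminOno

end

/-! The proof takes place on the Fourier side, where the equation is a system of ordinary
differential equations for the coefficients `v(n)`, of vector field `boField`.

*Energy estimates.* For an even weight `w`, the derivative in time of the energy `∑ w(n) |v(n)|²` is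
a cubic form in `v`, over the triples of frequencies `a + b + c = 0`. After symmetrisation its
symbol is `a w(a) + b w(b) + c w(c)`, and if `w` is monotone in `|n|` and of at most polynomial
relative growth (`IsAdmissible`), this is at most a constant times the lowest frequency multiplied
by the geometric mean of the weights of the two others (`IsAdmissible.symbol_le`). Hence the
derivative of the energy is bounded by the energy times `∑ |n| |v(n)|`, a quantity controlled by the
`H²` norm. In the case of `H²` itself this is a differential inequality which gives a bound up to a
time depending on `R` alone (`lifetime`, `IsGalerkin.energy_weightTwo_le`); up to that time the
energy of every admissible weight grows by a bounded factor only (`IsGalerkin.energy_le`). The same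
symmetrisation shows that the solutions of the equations truncated at the frequencies `N ≤ M`, with
the same datum, differ by `O(N^{-1/2})` in `L²` (`sum_sq_difference_le`). All these sums are finite,
since truncated solutions split into a trigonometric polynomial (`IsGalerkin`) and high frequencies
of constant modulus.

*Existence.* The truncated equations are globally solvable by conservation of the `L²` norm
(`exists_isGalerkin`). By the difference estimate their solutions converge as the truncation is
removed, and the limit solves the Benjamin-Ono equation (`IsGalerkinLimit.hasDerivAt`). It is
continuous in time with values in `H^σ`, for the exponent `σ` of the datum itself, because the
Sobolev weights of order `σ` damped below a frequency `K` are admissible uniformly in `K`, so that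
the high frequencies of the solution are small uniformly in time
(`IsGalerkinLimit.tendsto_tsum_sub`).

*Comparison.* A given solution of the truncated equation and the solution of the Benjamin-Ono
equation with the same datum are close in `L²` and bounded in `H^σ`, with constants which depend on
`σ` and `R` only (`IsGalerkinLimit.sum_sub_truncated_le`), and one interpolates. -/

namespace BenjaminOno

/-! ### Weights on the frequencies -/

/-- A weight on the Fourier modes which, as a function of `|n|`, is nondecreasing but grows no
faster than `(1 + n²)^p`, in the sense that its quotient by this power is nonincreasing. -/
structure IsAdmissible (p : ℝ) (w : ℤ → ℝ) : Prop where
  nonneg : ∀ n, 0 ≤ w n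
  mono : ∀ a b : ℤ, |a| ≤ |b| → w a ≤ w b
  growth : ∀ a b : ℤ, |a| ≤ |b| →
    w b * (1 + (a : ℝ) ^ 2) ^ p ≤ w a * (1 + (b : ℝ) ^ 2) ^ p

lemma one_le_bracket (n : ℤ) : (1 : ℝ) ≤ 1 + (n : ℝ) ^ 2 := by
  nlinarith [sq_nonneg (n : ℝ)]

lemma bracket_pos (n : ℤ) : (0 : ℝ) < 1 + (n : ℝ) ^ 2 := by positivity

lemma bracket_mono {a b : ℤ} (h : |a| ≤ |b|) : 1 + (a : ℝ) ^ 2 ≤ 1 + (b : ℝ) ^ 2 := by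
  have : a ^ 2 ≤ b ^ 2 := sq_le_sq.2 h
  have h' : ((a ^ 2 : ℤ) : ℝ) ≤ ((b ^ 2 : ℤ) : ℝ) := by exact_mod_cast this
  push_cast at h'
  linarith

lemma isAdmissible_bracket {p : ℝ} (hp : 0 ≤ p) :
    IsAdmissible p fun n : ℤ => (1 + (n : ℝ) ^ 2) ^ p where
  nonneg n := by positivity
  mono a b h := Real.rpow_le_rpow (bracket_pos a).le (bracket_mono h) hp
  growth a b _ := (mul_comm _ _).le

/-- The Sobolev weight of order `p`, damped at the frequencies below `K`. -/
noncomputable def tailWeight (p : ℝ) (K : ℕ) (n : ℤ) : ℝ :=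
  (1 + (n : ℝ) ^ 2) ^ p * min 1 ((1 + (n : ℝ) ^ 2) / (1 + (K : ℝ) ^ 2))

lemma isAdmissible_tailWeight {p : ℝ} (hp : 0 ≤ p) (K : ℕ) :
    IsAdmissible (p + 1) (tailWeight p K) where
  nonneg n := by unfold tailWeight; positivity
  mono a b h := by
    unfold tailWeight
    have h1 := bracket_mono h
    have h2 := Real.rpow_le_rpow (bracket_pos a).le h1 hp
    gcongr
  growth a b h := by
    unfold tailWeight
    have h1 := bracket_mono h
    have ha := bracket_pos a
    have hb := bracket_pos b
    rw [Real.rpow_add_one ha.ne', Real.rpow_add_one hb.ne']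
    have key : min 1 ((1 + (b : ℝ) ^ 2) / (1 + (K : ℝ) ^ 2)) * (1 + (a : ℝ) ^ 2) ≤
        min 1 ((1 + (a : ℝ) ^ 2) / (1 + (K : ℝ) ^ 2)) * (1 + (b : ℝ) ^ 2) := by
      rw [min_mul_of_nonneg _ _ ha.le, min_mul_of_nonneg _ _ hb.le]
      refine min_le_min (by linarith) (le_of_eq ?_)
      ring
    calc _ = (1 + (b : ℝ) ^ 2) ^ p * (1 + (a : ℝ) ^ 2) ^ p *
          (min 1 ((1 + (b : ℝ) ^ 2) / (1 + (K : ℝ) ^ 2)) * (1 + (a : ℝ) ^ 2)) := by ring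
      _ ≤ (1 + (b : ℝ) ^ 2) ^ p * (1 + (a : ℝ) ^ 2) ^ p *
          (min 1 ((1 + (a : ℝ) ^ 2) / (1 + (K : ℝ) ^ 2)) * (1 + (b : ℝ) ^ 2)) := by gcongr
      _ = _ := by ring

lemma tailWeight_le (p : ℝ) (K : ℕ) (n : ℤ) : tailWeight p K n ≤ (1 + (n : ℝ) ^ 2) ^ p := by
  unfold tailWeight
  exact mul_le_of_le_one_right (by positivity) (min_le_left _ _)

lemma tailWeight_eq {p : ℝ} {K : ℕ} {n : ℤ} (h : (K : ℤ) ≤ |n|) :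
    tailWeight p K n = (1 + (n : ℝ) ^ 2) ^ p := by
  unfold tailWeight
  have h1 : |(K : ℤ)| ≤ |n| := by simpa using h
  have := bracket_mono h1
  rw [min_eq_left, mul_one]
  rw [le_div_iff₀ (by positivity)]
  simpa using this

lemma tendsto_tailWeight (p : ℝ) (n : ℤ) :
    Tendsto (fun K : ℕ => tailWeight p K n) atTop (𝓝 0) := by
  have h1 : Tendsto (fun K : ℕ => (1 + (n : ℝ) ^ 2) ^ p *
      ((1 + (n : ℝ) ^ 2) / (1 + (K : ℝ) ^ 2))) atTop (𝓝 0) := by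
    rw [← mul_zero ((1 + (n : ℝ) ^ 2) ^ p)]
    refine Tendsto.const_mul _ (Tendsto.const_div_atTop ?_ _)
    refine tendsto_atTop_add_const_left _ _ ?_
    exact (tendsto_pow_atTop two_ne_zero).comp tendsto_natCast_atTop_atTop
  refine squeeze_zero (fun K => by unfold tailWeight; positivity) (fun K => ?_) h1
  unfold tailWeight
  gcongr
  exact min_le_right _ _

/-- The constant of the symbol estimate for an admissible weight of order `p`. -/
noncomputable def symbolConst (p : ℝ) : ℝ := 8 * p * 4 ^ p + 1

lemma symbolConst_pos {p : ℝ} (hp : 1 ≤ p) : 0 < symbolConst p := by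
  unfold symbolConst
  have : 0 < p := by linarith
  positivity

lemma IsAdmissible.even {p : ℝ} {w : ℤ → ℝ} (hw : IsAdmissible p w) (n : ℤ) : w (-n) = w n :=
  le_antisymm (hw.mono _ _ (abs_neg n).le) (hw.mono _ _ (abs_neg n).ge)

/-- Discrete derivative bound for an admissible weight, for two comparable frequencies. -/
lemma IsAdmissible.abs_mul_sub_le {p : ℝ} (hp : 1 ≤ p) {w : ℤ → ℝ} (hw : IsAdmissible p w)
    {a b c : ℤ} (h : a + b + c = 0) (hab : |a| ≤ |b|) (hca : |c| ≤ |a|) :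
    |(b : ℝ)| * (w b - w a) ≤ 8 * p * 4 ^ p * |(c : ℝ)| * w a := by
  have hA := bracket_pos a
  have hB := bracket_pos b
  have hAB := bracket_mono hab
  have hg := hw.growth a b hab
  have hw0 := hw.nonneg a
  have h1 : |(b : ℝ)| ≤ |(a : ℝ)| + |(c : ℝ)| := by
    have : (b : ℝ) = -(a + c) := by
      have : (a : ℝ) + b + c = 0 := by exact_mod_cast h
      linarith
    rw [this, abs_neg]; exact abs_add_le _ _
  have h2 : |(c : ℝ)| ≤ |(a : ℝ)| := by exact_mod_cast hca
  have h3 : |(a : ℝ)| ≤ |(b : ℝ)| := by exact_mod_cast hab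
  set A := 1 + (a : ℝ) ^ 2 with hAdef
  set B := 1 + (b : ℝ) ^ 2 with hBdef
  have hb2 : (b : ℝ) ^ 2 = |(b : ℝ)| ^ 2 := (sq_abs _).symm
  have ha2 : (a : ℝ) ^ 2 = |(a : ℝ)| ^ 2 := (sq_abs _).symm
  have hc0 := abs_nonneg (c : ℝ)
  have ha0 := abs_nonneg (a : ℝ)
  have hb0 := abs_nonneg (b : ℝ)
  have hB4 : B ≤ 4 * A := by rw [hAdef, hBdef, hb2, ha2]; nlinarith
  -- Bernoulli's inequality, applied to `A / B ≤ 1`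
  have hbern : 1 + p * (A / B - 1) ≤ (A / B) ^ p := by
    have := one_add_mul_self_le_rpow_one_add (s := A / B - 1)
      (by have : 0 ≤ A / B := by positivity
          linarith) hp
    simpa using this
  rw [Real.div_rpow hA.le hB.le] at hbern
  have hBp : 0 < B ^ p := by positivity
  have hAp : 0 < A ^ p := by positivity
  have hBA : B ^ p ≤ 4 ^ p * A ^ p := by
    rw [← Real.mul_rpow (by norm_num) hA.le]
    exact Real.rpow_le_rpow hB.le hB4 (by linarith)
  have h5 : B ^ p - A ^ p ≤ p * ((B - A) / B) * B ^ p := by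
    have := mul_le_mul_of_nonneg_right hbern hBp.le
    rw [div_mul_cancel₀ _ hBp.ne'] at this
    have e : A / B - 1 = -((B - A) / B) := by field_simp; ring
    rw [e] at this
    linarith
  have h6 : w b - w a ≤ w a * (p * ((B - A) / B) * 4 ^ p) := by
    have h7 : (w b - w a) * A ^ p ≤ w a * (p * ((B - A) / B) * 4 ^ p) * A ^ p := by
      calc (w b - w a) * A ^ p ≤ w a * (B ^ p - A ^ p) := by linarith
        _ ≤ w a * (p * ((B - A) / B) * B ^ p) := by gcongr
        _ ≤ w a * (p * ((B - A) / B) * (4 ^ p * A ^ p)) := by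
          have : 0 ≤ (B - A) / B := div_nonneg (by linarith) hB.le
          gcongr
        _ = _ := by ring
    exact le_of_mul_le_mul_right h7 hAp
  have h8 : |(b : ℝ)| * ((B - A) / B) ≤ 2 * |(c : ℝ)| := by
    rw [← mul_div_assoc, div_le_iff₀ hB, hAdef, hBdef, hb2, ha2]
    have e1 : 1 + |(b : ℝ)| ^ 2 - (1 + |(a : ℝ)| ^ 2) =
      (|(b : ℝ)| - |(a : ℝ)|) * (|(b : ℝ)| + |(a : ℝ)|) := by ring
    rw [e1]
    have e2 : (|(b : ℝ)| - |(a : ℝ)|) * (|(b : ℝ)| + |(a : ℝ)|) ≤ |(c : ℝ)| * (2 * |(b : ℝ)|) :=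
      mul_le_mul (by linarith) (by linarith) (by positivity) hc0
    calc _ ≤ |(b : ℝ)| * (|(c : ℝ)| * (2 * |(b : ℝ)|)) := by gcongr
      _ ≤ _ := by nlinarith
  calc |(b : ℝ)| * (w b - w a) ≤ |(b : ℝ)| * (w a * (p * ((B - A) / B) * 4 ^ p)) := by gcongr
    _ = w a * p * 4 ^ p * (|(b : ℝ)| * ((B - A) / B)) := by ring
    _ ≤ w a * p * 4 ^ p * (2 * |(c : ℝ)|) := by
      have : 0 < p := by linarith
      gcongr
    _ ≤ _ := by
      have : 0 ≤ w a * p * 4 ^ p * |(c : ℝ)| := by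
        have : 0 < p := by linarith
        positivity
      linarith

lemma IsAdmissible.symbol_le_aux {p : ℝ} (hp : 1 ≤ p) {w : ℤ → ℝ} (hw : IsAdmissible p w)
    {a b c : ℤ} (h : a + b + c = 0) (hab : |a| ≤ |b|) (hca : |c| ≤ |a|) :
    |a * w a + b * w b + c * w c| ≤ symbolConst p * (|(c : ℝ)| * (√(w a) * √(w b))) := by
  have h0 : (a : ℝ) = -b - c := by
    have : (a : ℝ) + b + c = 0 := by exact_mod_cast h
    linarith
  have hwa := hw.nonneg a
  have hwc := hw.nonneg c
  have h1 := hw.abs_mul_sub_le hp h hab hca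
  have h2 := hw.mono _ _ hab
  have h3 := hw.mono _ _ hca
  have h4 : w a ≤ √(w a) * √(w b) := by
    calc w a = √(w a) * √(w a) := (Real.mul_self_sqrt hwa).symm
      _ ≤ _ := by gcongr
  have e : a * w a + b * w b + c * w c = b * (w b - w a) + c * (w c - w a) := by
    rw [h0]; ring
  have h5 : |(c : ℝ)| * |w c - w a| ≤ |(c : ℝ)| * w a := by
    gcongr
    rw [abs_le]; constructor <;> linarith
  have hc0 := abs_nonneg (c : ℝ)
  calc |a * w a + b * w b + c * w c| ≤ |(b : ℝ)| * (w b - w a) + |(c : ℝ)| * w a := by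
        rw [e]
        refine (abs_add_le _ _).trans ?_
        rw [abs_mul, abs_mul, abs_of_nonneg (sub_nonneg.2 h2)]
        gcongr
    _ ≤ symbolConst p * (|(c : ℝ)| * w a) := by unfold symbolConst; linarith
    _ ≤ _ := by
      have := symbolConst_pos hp
      gcongr

/-- The commutator estimate on the Fourier side: in the symmetrised symbol of the energy identity
the derivative falls on the factor of lowest frequency. -/
lemma IsAdmissible.symbol_le {p : ℝ} (hp : 1 ≤ p) {w : ℤ → ℝ} (hw : IsAdmissible p w)
    {a b c : ℤ} (h : a + b + c = 0) :
    |a * w a + b * w b + c * w c| ≤ symbolConst p *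
      (|(a : ℝ)| * (√(w b) * √(w c)) + |(b : ℝ)| * (√(w a) * √(w c)) +
        |(c : ℝ)| * (√(w a) * √(w b))) := by
  have hC := symbolConst_pos hp
  have ta : 0 ≤ |(a : ℝ)| * (√(w b) * √(w c)) := by positivity
  have tb : 0 ≤ |(b : ℝ)| * (√(w a) * √(w c)) := by positivity
  have tc : 0 ≤ |(c : ℝ)| * (√(w a) * √(w b)) := by positivity
  have fin : ∀ {x y : ℝ}, x ≤ symbolConst p * y →
      y ≤ |(a : ℝ)| * (√(w b) * √(w c)) + |(b : ℝ)| * (√(w a) * √(w c)) +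
        |(c : ℝ)| * (√(w a) * √(w b)) → x ≤ symbolConst p *
      (|(a : ℝ)| * (√(w b) * √(w c)) + |(b : ℝ)| * (√(w a) * √(w c)) +
        |(c : ℝ)| * (√(w a) * √(w b))) := fun h1 h2 => h1.trans (by gcongr)
  rcases le_total |a| |b| with hab | hab <;> rcases le_total |a| |c| with hac | hac <;>
    rcases le_total |b| |c| with hbc | hbc
  · have := hw.symbol_le_aux hp (a := b) (b := c) (c := a) (by omega) hbc hab
    rw [show a * w a + b * w b + c * w c = b * w b + c * w c + a * w a by ring]
    exact fin this (by linarith)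
  · have := hw.symbol_le_aux hp (a := c) (b := b) (c := a) (by omega) hbc hac
    rw [show a * w a + b * w b + c * w c = c * w c + b * w b + a * w a by ring]
    exact fin this (by linarith)
  · have := hw.symbol_le_aux hp (a := b) (b := c) (c := a) (by omega) hbc hab
    rw [show a * w a + b * w b + c * w c = b * w b + c * w c + a * w a by ring]
    exact fin this (by linarith)
  · have := hw.symbol_le_aux hp (a := a) (b := b) (c := c) (by omega) hab hac
    exact fin this (by linarith)
  · have := hw.symbol_le_aux hp (a := a) (b := c) (c := b) (by omega) hac hab
    rw [show a * w a + b * w b + c * w c = a * w a + c * w c + b * w b by ring]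
    exact fin this (by linarith)
  · have := hw.symbol_le_aux hp (a := a) (b := c) (c := b) (by omega) hac hab
    rw [show a * w a + b * w b + c * w c = a * w a + c * w c + b * w b by ring]
    exact fin this (by linarith)
  · have := hw.symbol_le_aux hp (a := c) (b := a) (c := b) (by omega) hac hbc
    rw [show a * w a + b * w b + c * w c = c * w c + a * w a + b * w b by ring]
    exact fin this (by linarith)
  · have := hw.symbol_le_aux hp (a := b) (b := a) (c := c) (by omega) hab hbc
    rw [show a * w a + b * w b + c * w c = b * w b + a * w a + c * w c by ring]
    exact fin this (by linarith)

/-! ### Trilinear sums over resonant frequencies -/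

/-- The frequencies `|n| ≤ N`. -/
noncomputable def modes (N : ℕ) : Finset ℤ := Finset.Icc (-(N : ℤ)) N

@[simp]
lemma mem_modes {N : ℕ} {n : ℤ} : n ∈ modes N ↔ |n| ≤ N := by
  simp [modes, abs_le]

lemma modes_mono {N M : ℕ} (h : N ≤ M) : modes N ⊆ modes M := fun n hn => by
  rw [mem_modes] at *
  exact hn.trans (by exact_mod_cast h)

lemma sum_modes_neg {A : Type*} [AddCommMonoid A] (N : ℕ) (f : ℤ → A) :
    ∑ n ∈ modes N, f (-n) = ∑ n ∈ modes N, f n :=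
  Finset.sum_bij' (fun n _ => -n) (fun n _ => -n) (by simp) (by simp) (by simp) (by simp)
    (by simp)

/-- The sum of `f a b c` over the triples of frequencies in `S` of zero sum. -/
def triSum {A : Type*} [AddCommMonoid A] (S : Finset ℤ) (f : ℤ → ℤ → ℤ → A) : A :=
  ∑ a ∈ S, ∑ b ∈ S, ∑ c ∈ S, if a + b + c = 0 then f a b c else 0

section TriSum

variable {S : Finset ℤ}

lemma triSum_swap_left {A : Type*} [AddCommMonoid A] (f : ℤ → ℤ → ℤ → A) :
    triSum S f = triSum S fun a b c => f b a c := by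
  unfold triSum
  rw [Finset.sum_comm]
  refine Finset.sum_congr rfl fun b _ => Finset.sum_congr rfl fun a _ =>
    Finset.sum_congr rfl fun c _ => ?_
  rw [add_comm a b]

lemma triSum_swap_right {A : Type*} [AddCommMonoid A] (f : ℤ → ℤ → ℤ → A) :
    triSum S f = triSum S fun a b c => f a c b := by
  unfold triSum
  refine Finset.sum_congr rfl fun a _ => ?_
  rw [Finset.sum_comm]
  refine Finset.sum_congr rfl fun b _ => Finset.sum_congr rfl fun c _ => ?_
  rw [add_right_comm]

lemma triSum_congr {A : Type*} [AddCommMonoid A] {f g : ℤ → ℤ → ℤ → A}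
    (h : ∀ a b c, a + b + c = 0 → f a b c = g a b c) : triSum S f = triSum S g := by
  unfold triSum
  refine Finset.sum_congr rfl fun a _ => Finset.sum_congr rfl fun b _ =>
    Finset.sum_congr rfl fun c _ => ?_
  split_ifs with h0
  · exact h a b c h0
  · rfl

lemma triSum_add {A : Type*} [AddCommMonoid A] (f g : ℤ → ℤ → ℤ → A) :
    triSum S (fun a b c => f a b c + g a b c) = triSum S f + triSum S g := by
  unfold triSum
  simp only [← Finset.sum_add_distrib]
  refine Finset.sum_congr rfl fun a _ => Finset.sum_congr rfl fun b _ =>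
    Finset.sum_congr rfl fun c _ => ?_
  split_ifs <;> simp

lemma triSum_mul {A : Type*} [Semiring A] (k : A) (f : ℤ → ℤ → ℤ → A) :
    triSum S (fun a b c => k * f a b c) = k * triSum S f := by
  unfold triSum
  simp only [Finset.mul_sum]
  refine Finset.sum_congr rfl fun a _ => Finset.sum_congr rfl fun b _ =>
    Finset.sum_congr rfl fun c _ => ?_
  split_ifs <;> simp

lemma triSum_le_triSum {f g : ℤ → ℤ → ℤ → ℝ} (h : ∀ a b c, a + b + c = 0 → f a b c ≤ g a b c) :
    triSum S f ≤ triSum S g := by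
  unfold triSum
  refine Finset.sum_le_sum fun a _ => Finset.sum_le_sum fun b _ =>
    Finset.sum_le_sum fun c _ => ?_
  split_ifs with h0
  · exact h a b c h0
  · rfl

lemma norm_triSum_le {f : ℤ → ℤ → ℤ → ℂ} {g : ℤ → ℤ → ℤ → ℝ}
    (h : ∀ a b c, a + b + c = 0 → ‖f a b c‖ ≤ g a b c) : ‖triSum S f‖ ≤ triSum S g := by
  unfold triSum
  refine norm_sum_le_of_le _ fun a _ => norm_sum_le_of_le _ fun b _ =>
    norm_sum_le_of_le _ fun c _ => ?_
  split_ifs with h0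
  · exact h a b c h0
  · simp

/-- The convolution estimate `ℓ¹ * ℓ² ⊆ ℓ²` in dual form. -/
lemma triSum_mul_le {p q r : ℤ → ℝ} (hp : ∀ n, 0 ≤ p n) :
    triSum S (fun a b c => p c * (q a * r b)) ≤
      (∑ c ∈ S, p c) * ((∑ a ∈ S, q a ^ 2 + ∑ b ∈ S, r b ^ 2) / 2) := by
  have h1 : triSum S (fun a b c => p c * (q a * r b)) ≤
      triSum S (fun a b c => p c * (q a ^ 2 / 2) + p c * (r b ^ 2 / 2)) := by
    refine triSum_le_triSum fun a b c _ => ?_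
    rw [← mul_add]
    exact mul_le_mul_of_nonneg_left (by nlinarith [sq_nonneg (q a - r b)]) (hp c)
  have h2 : ∀ t : ℤ → ℝ, triSum S (fun a b c => p c * (t a ^ 2 / 2)) ≤
      (∑ c ∈ S, p c) * ((∑ a ∈ S, t a ^ 2) / 2) := by
    intro t
    rw [triSum_swap_right]
    unfold triSum
    rw [Finset.sum_div, Finset.mul_sum]
    refine Finset.sum_le_sum fun a _ => ?_
    rw [Finset.sum_mul]
    refine Finset.sum_le_sum fun b _ => ?_
    have h0 : 0 ≤ p b * (t a ^ 2 / 2) := mul_nonneg (hp b) (by positivity)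
    have e : ∀ c, (if a + b + c = 0 then p b * (t a ^ 2 / 2) else 0) =
        if c = -a - b then p b * (t a ^ 2 / 2) else 0 := fun c => by
      congr 1; rw [eq_iff_iff]; omega
    simp only [e, Finset.sum_ite_eq']
    split_ifs
    · rfl
    · exact h0
  calc _ ≤ _ := h1
    _ = triSum S (fun a b c => p c * (q a ^ 2 / 2)) +
        triSum S (fun a b c => p c * (r a ^ 2 / 2)) := by
      rw [triSum_add]; congr 1; exact triSum_swap_left _
    _ ≤ _ := add_le_add (h2 q) (h2 r)
    _ = _ := by ring

/-- Symmetrisation of the cubic form in the energy identity. -/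
lemma three_mul_triSum_energy (w : ℤ → ℝ) (v : ℤ → ℂ) :
    3 * triSum S (fun a b c => Complex.I * a * w a * (v a * v b * v c)) =
      triSum S fun a b c =>
        Complex.I * ((a * w a + b * w b + c * w c : ℝ) : ℂ) * (v a * v b * v c) := by
  set T := triSum S fun a b c => Complex.I * a * w a * (v a * v b * v c) with hT
  have e1 : T = triSum S fun a b c => Complex.I * b * w b * (v a * v b * v c) := by
    rw [hT, triSum_swap_left]
    exact triSum_congr fun a b c _ => by ring
  have e2 : T = triSum S fun a b c => Complex.I * c * w c * (v a * v b * v c) := by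
    rw [e1, triSum_swap_right]
    exact triSum_congr fun a b c _ => by ring
  have : 3 * T = T + T + T := by ring
  rw [this]
  nth_rewrite 2 [e1]
  nth_rewrite 2 [e2]
  rw [hT, ← triSum_add, ← triSum_add]
  refine triSum_congr fun a b c _ => ?_
  push_cast
  ring

/-- Commutator estimate: the energy of weight `w` loses no derivative. -/
lemma norm_triSum_energy_le {p : ℝ} (hp : 1 ≤ p) {w : ℤ → ℝ} (hw : IsAdmissible p w)
    (v : ℤ → ℂ) :
    ‖triSum S fun a b c => Complex.I * a * w a * (v a * v b * v c)‖ ≤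
      symbolConst p * (∑ c ∈ S, |(c : ℝ)| * ‖v c‖) * ∑ a ∈ S, w a * ‖v a‖ ^ 2 := by
  set T := triSum S fun a b c => Complex.I * a * w a * (v a * v b * v c) with hT
  have e3 := three_mul_triSum_energy (S := S) w v
  rw [← hT] at e3
  let q : ℤ → ℝ := fun n => √(w n) * ‖v n‖
  let d : ℤ → ℝ := fun n => |(n : ℝ)| * ‖v n‖
  have hq : ∑ a ∈ S, q a ^ 2 = ∑ a ∈ S, w a * ‖v a‖ ^ 2 :=
    Finset.sum_congr rfl fun a _ => by simp only [q]; rw [mul_pow, Real.sq_sqrt (hw.nonneg a)]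
  have h1 : triSum S (fun a b c => d c * (q a * q b)) ≤
      (∑ c ∈ S, d c) * ∑ a ∈ S, w a * ‖v a‖ ^ 2 := by
    have := triSum_mul_le (S := S) (p := d) (q := q) (r := q) (fun n => by positivity)
    rwa [hq, add_self_div_two] at this
  have h2 : triSum S (fun a b c => d b * (q a * q c)) =
      triSum S (fun a b c => d c * (q a * q b)) := triSum_swap_right _
  have h3 : triSum S (fun a b c => d a * (q b * q c)) =
      triSum S (fun a b c => d c * (q a * q b)) := by
    rw [triSum_swap_left, h2]
  have hC := symbolConst_pos hp
  have h4 : ‖3 * T‖ ≤ symbolConst p * (3 * triSum S (fun a b c => d c * (q a * q b))) := by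
    rw [e3]
    calc _ ≤ triSum S (fun a b c => symbolConst p *
          (d a * (q b * q c) + d b * (q a * q c) + d c * (q a * q b))) := by
          refine norm_triSum_le fun a b c h => ?_
          rw [norm_mul, norm_mul, norm_mul, norm_mul, Complex.norm_I, one_mul,
            Complex.norm_real, Real.norm_eq_abs]
          calc _ ≤ _ := mul_le_mul_of_nonneg_right (hw.symbol_le hp h) (by positivity)
            _ = _ := by simp only [q, d]; ring
      _ = _ := by
          rw [triSum_mul, triSum_add, triSum_add, h2, h3]; ring
  rw [norm_mul] at h4
  norm_num at h4
  have h5 := mul_le_mul_of_nonneg_left h1 hC.le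
  simp only [d] at h5 h4
  nlinarith

/-- The quadratic term of the difference equation loses no derivative in `ℓ²`. -/
lemma norm_triSum_difference_le (z g : ℤ → ℂ) :
    ‖triSum S fun a b c => Complex.I * a * (z a * z b * g c)‖ ≤
      (∑ c ∈ S, |(c : ℝ)| * ‖g c‖) * ∑ a ∈ S, ‖z a‖ ^ 2 := by
  set T := triSum S fun a b c => Complex.I * a * (z a * z b * g c) with hT
  have e2 : 2 * T = triSum S fun a b c => -(Complex.I * c) * (z a * z b * g c) := by
    have e1 : T = triSum S fun a b c => Complex.I * b * (z a * z b * g c) := by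
      rw [hT, triSum_swap_left]
      exact triSum_congr fun a b c _ => by ring
    rw [two_mul]
    nth_rewrite 2 [e1]
    rw [hT, ← triSum_add]
    refine triSum_congr fun a b c h => ?_
    have : (c : ℂ) = -(a + b) := by
      have : (a : ℂ) + b + c = 0 := by exact_mod_cast h
      linear_combination this
    rw [this]; ring
  have h1 := triSum_mul_le (S := S) (p := fun c => |(c : ℝ)| * ‖g c‖) (q := fun n => ‖z n‖)
    (r := fun n => ‖z n‖) (fun n => by positivity)
  rw [add_self_div_two] at h1
  have h2 : ‖2 * T‖ ≤ triSum S (fun a b c => |(c : ℝ)| * ‖g c‖ * (‖z a‖ * ‖z b‖)) := by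
    rw [e2]
    refine norm_triSum_le fun a b c _ => le_of_eq ?_
    simp only [norm_mul, norm_neg, Complex.norm_I, Complex.norm_intCast]
    ring
  rw [norm_mul] at h2
  norm_num at h2
  linarith [norm_nonneg T]

/-- The part of the nonlinearity of frequencies above `N` is small, at the price of two
derivatives. -/
lemma norm_triSum_high_le {N : ℕ} (hN : 0 < N) (z v : ℤ → ℂ) :
    ‖triSum S fun a b c => (if |a| ≤ (N : ℤ) then 0 else Complex.I * a) * (z a * v b * v c)‖ ≤
      2 / N * (∑ c ∈ S, ‖v c‖) * (∑ a ∈ S, ‖z a‖ ^ 2 + ∑ b ∈ S, (b : ℝ) ^ 4 * ‖v b‖ ^ 2) := by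
  have hN' : (0 : ℝ) < N := by exact_mod_cast hN
  let y : ℤ → ℝ := fun b => (b : ℝ) ^ 2 * ‖v b‖
  have h1 := triSum_mul_le (S := S) (p := fun c => ‖v c‖) (q := fun n => ‖z n‖)
    (r := y) (fun n => by positivity)
  have hy : ∑ b ∈ S, y b ^ 2 = ∑ b ∈ S, (b : ℝ) ^ 4 * ‖v b‖ ^ 2 :=
    Finset.sum_congr rfl fun b _ => by simp only [y]; ring
  rw [hy] at h1
  have h2 : triSum S (fun a b c => ‖v b‖ * (‖z a‖ * y c)) =
      triSum S (fun a b c => ‖v c‖ * (‖z a‖ * y b)) := triSum_swap_right _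
  calc _ ≤ triSum S (fun a b c =>
        2 / N * (‖v b‖ * (‖z a‖ * y c) + ‖v c‖ * (‖z a‖ * y b))) := by
        refine norm_triSum_le fun a b c h => ?_
        have ht : 0 ≤ ‖z a‖ * ‖v b‖ * ‖v c‖ := by positivity
        have e : 2 / N * (‖v b‖ * (‖z a‖ * y c) + ‖v c‖ * (‖z a‖ * y b)) =
            (2 / N * ((b : ℝ) ^ 2 + (c : ℝ) ^ 2)) * (‖z a‖ * ‖v b‖ * ‖v c‖) := by
          simp only [y]; ring
        rw [e, norm_mul, norm_mul, norm_mul]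
        refine mul_le_mul_of_nonneg_right ?_ ht
        split_ifs with ha
        · rw [norm_zero]; positivity
        · -- `|a| ≤ a² / N`, and `a = -(b + c)`
          have ha' : (N : ℝ) ≤ |(a : ℝ)| := by
            have : (N : ℤ) ≤ |a| := (not_le.1 ha).le
            exact_mod_cast this
          have habc : (a : ℝ) = -(b + c) := by
            have : (a : ℝ) + b + c = 0 := by exact_mod_cast h
            linarith
          rw [norm_mul, Complex.norm_I, one_mul, Complex.norm_intCast, div_mul_eq_mul_div,
            le_div_iff₀ hN']
          calc |(a : ℝ)| * N ≤ |(a : ℝ)| * |(a : ℝ)| := by gcongr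
            _ = (b + c : ℝ) ^ 2 := by rw [abs_mul_abs_self, habc]; ring
            _ ≤ _ := by nlinarith [sq_nonneg ((b : ℝ) - c)]
    _ = 2 / N * (2 * triSum S (fun a b c => ‖v c‖ * (‖z a‖ * y b))) := by
        rw [triSum_mul, triSum_add, h2]; ring
    _ ≤ 2 / N * (2 * ((∑ c ∈ S, ‖v c‖) * ((∑ a ∈ S, ‖z a‖ ^ 2 +
        ∑ b ∈ S, (b : ℝ) ^ 4 * ‖v b‖ ^ 2) / 2))) := by gcongr
    _ = _ := by ring

end TriSum

/-! ### The equation on the Fourier side -/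

/-- The convolution of two sequences. -/
noncomputable def conv (f g : ℤ → ℂ) (n : ℤ) : ℂ := ∑' b, f b * g (n - b)

/-- The vector field of the Benjamin-Ono equation, in terms of the Fourier coefficients. -/
noncomputable def boField (v : ℤ → ℂ) (n : ℤ) : ℂ :=
  -(Complex.I * (Int.sign n : ℂ) * (n : ℂ) ^ 2 * v n) - Complex.I * n / 2 * conv v v n

/-- `v` is the sequence of the Fourier coefficients of a real trigonometric polynomial of degree
at most `N` and zero mean value. -/
structure IsRealTrig (N : ℕ) (v : ℤ → ℂ) : Prop where
  conj : ∀ n, v (-n) = star (v n)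
  zero : v 0 = 0
  supp : ∀ n : ℤ, ¬ |n| ≤ N → v n = 0

lemma IsRealTrig.mono {N M : ℕ} {v : ℤ → ℂ} (hv : IsRealTrig N v) (h : N ≤ M) :
    IsRealTrig M v :=
  ⟨hv.conj, hv.zero, fun n hn => hv.supp n fun h' => hn (h'.trans (by exact_mod_cast h))⟩

lemma IsRealTrig.add {N : ℕ} {u v : ℤ → ℂ} (hu : IsRealTrig N u) (hv : IsRealTrig N v) :
    IsRealTrig N fun n => u n + v n :=
  ⟨fun n => by rw [hu.conj, hv.conj, star_add], by rw [hu.zero, hv.zero, add_zero],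
    fun n hn => by rw [hu.supp n hn, hv.supp n hn, add_zero]⟩

lemma IsRealTrig.sub {N : ℕ} {u v : ℤ → ℂ} (hu : IsRealTrig N u) (hv : IsRealTrig N v) :
    IsRealTrig N fun n => u n - v n :=
  ⟨fun n => by rw [hu.conj, hv.conj, star_sub], by rw [hu.zero, hv.zero, sub_zero],
    fun n hn => by rw [hu.supp n hn, hv.supp n hn, sub_zero]⟩

lemma conv_eq_sum {N : ℕ} {f g : ℤ → ℂ} (hf : IsRealTrig N f) (hg : IsRealTrig N g) (n : ℤ) :
    conv f g n = ∑ b ∈ modes N, ∑ c ∈ modes N, if b + c = n then f b * g c else 0 := by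
  unfold conv
  rw [tsum_eq_sum (s := modes N)
    (fun b hb => by rw [hf.supp b (by simpa using hb), zero_mul])]
  refine Finset.sum_congr rfl fun b _ => ?_
  have e : ∀ c, (if b + c = n then f b * g c else 0) = if c = n - b then f b * g c else 0 :=
    fun c => by congr 1; rw [eq_iff_iff]; omega
  simp only [e, Finset.sum_ite_eq']
  split_ifs with h
  · rfl
  · rw [hg.supp _ (by simpa using h), mul_zero]

lemma sum_pairing_conv {N : ℕ} {x f g : ℤ → ℂ} (hx : IsRealTrig N x) (hf : IsRealTrig N f)
    (hg : IsRealTrig N g) (W : ℤ → ℂ) :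
    ∑ n ∈ modes N, W n * (star (x n) * conv f g n) =
      triSum (modes N) fun a b c => W (-a) * (x a * f b * g c) := by
  rw [← sum_modes_neg]
  unfold triSum
  refine Finset.sum_congr rfl fun a _ => ?_
  rw [conv_eq_sum hf hg, hx.conj, star_star]
  simp only [Finset.mul_sum]
  refine Finset.sum_congr rfl fun b _ => Finset.sum_congr rfl fun c _ => ?_
  have : b + c = -a ↔ a + b + c = 0 := by omega
  simp only [this]
  split_ifs
  · ring
  · simp

/-- The energy identity. The dispersive term, of purely imaginary symbol, does not contribute. -/
lemma sum_energy_eq {N : ℕ} {v : ℤ → ℂ} (hv : IsRealTrig N v) {p : ℝ} {w : ℤ → ℝ}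
    (hw : IsAdmissible p w) :
    ∑ n ∈ modes N, w n * (2 * (star (v n) * boField v n).re) =
      (triSum (modes N) fun a b c => Complex.I * a * w a * (v a * v b * v c)).re := by
  have h := sum_pairing_conv hv hv hv (fun n => -(Complex.I * n * w n))
  have e : (triSum (modes N) fun a b c => Complex.I * a * w a * (v a * v b * v c)) =
      ∑ n ∈ modes N, -(Complex.I * n * w n) * (star (v n) * conv v v n) := by
    rw [h]
    refine triSum_congr fun a b c _ => ?_
    rw [hw.even]; push_cast; ring
  rw [e, Complex.re_sum]
  refine Finset.sum_congr rfl fun n _ => ?_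
  have h1 : star (v n) * boField v n =
      -(Complex.I * ((Int.sign n * n ^ 2 * Complex.normSq (v n) : ℝ) : ℂ)) -
        Complex.I * n / 2 * (star (v n) * conv v v n) := by
    unfold boField
    push_cast
    rw [Complex.normSq_eq_conj_mul_self]
    simp only [Complex.star_def]
    ring
  have h2 : w n * (2 * (star (v n) * boField v n).re) =
      ((w n * 2 : ℝ) * (star (v n) * boField v n)).re := by
    rw [Complex.re_ofReal_mul]; ring
  rw [h2, h1]
  have h3 : ((w n * 2 : ℝ) : ℂ) *
        (-(Complex.I * ((Int.sign n * n ^ 2 * Complex.normSq (v n) : ℝ) : ℂ)) -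
          Complex.I * n / 2 * (star (v n) * conv v v n)) =
      -(Complex.I * n * w n) * (star (v n) * conv v v n) -
        ((w n * 2 * (Int.sign n * n ^ 2 * Complex.normSq (v n)) : ℝ) : ℂ) * Complex.I := by
    push_cast; ring
  rw [h3, Complex.sub_re, Complex.re_ofReal_mul, Complex.I_re, mul_zero, sub_zero]

/-! ### Two differential inequalities -/

/-- A form of Grönwall's lemma which does not distinguish a direction of time. -/
lemma add_le_mul_exp_of_abs_deriv_le {J : Set ℝ} (hJ : Convex ℝ J) {f f' : ℝ → ℝ} {K δ : ℝ}
    (hδ : 0 < δ) (hf : ∀ t ∈ J, 0 ≤ f t)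
    (hd : ∀ t ∈ J, HasDerivWithinAt f (f' t) J t) (hb : ∀ t ∈ J, |f' t| ≤ K * (f t + δ))
    {s t : ℝ} (hs : s ∈ J) (ht : t ∈ J) :
    f t + δ ≤ (f s + δ) * Real.exp (K * |t - s|) := by
  have hpos : ∀ t ∈ J, 0 < f t + δ := fun t ht => by linarith [hf t ht]
  have h1 : ∀ t ∈ J, HasDerivWithinAt (fun τ => Real.log (f τ + δ)) (f' t / (f t + δ)) J t :=
    fun t ht => ((hd t ht).add_const δ).log (hpos t ht).ne'
  have h2 := hJ.norm_image_sub_le_of_norm_hasDerivWithin_le (C := K) h1 (fun t ht => by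
    rw [Real.norm_eq_abs, abs_div, abs_of_pos (hpos t ht), div_le_iff₀ (hpos t ht)]
    exact hb t ht) hs ht
  rw [Real.norm_eq_abs, Real.norm_eq_abs] at h2
  have h3 : Real.log (f t + δ) ≤ Real.log (f s + δ) + K * |t - s| := by
    linarith [le_abs_self (Real.log (f t + δ) - Real.log (f s + δ))]
  have h4 := Real.exp_le_exp.2 h3
  rwa [Real.exp_log (hpos t ht), Real.exp_add, Real.exp_log (hpos s hs)] at h4

lemma le_mul_exp_of_abs_deriv_le {J : Set ℝ} (hJ : Convex ℝ J) {f f' : ℝ → ℝ} {K : ℝ}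
    (hK : 0 ≤ K) (hf : ∀ t ∈ J, 0 ≤ f t)
    (hd : ∀ t ∈ J, HasDerivWithinAt f (f' t) J t) (hb : ∀ t ∈ J, |f' t| ≤ K * f t)
    {s t : ℝ} (hs : s ∈ J) (ht : t ∈ J) :
    f t ≤ f s * Real.exp (K * |t - s|) := by
  refine le_of_forall_pos_le_add fun ε hε => ?_
  have hE := Real.exp_pos (K * |t - s|)
  have hδ : 0 < ε / Real.exp (K * |t - s|) := by positivity
  have := add_le_mul_exp_of_abs_deriv_le hJ hδ hf hd
    (fun t ht => (hb t ht).trans (mul_le_mul_of_nonneg_left (by linarith) hK)) hs ht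
  rw [add_mul, div_mul_cancel₀ _ hE.ne'] at this
  linarith

/-- The inequality `|f'| ≤ K f^{3/2}` bounds `f` for a time inversely proportional
to `√(f 0)`. -/
lemma le_of_abs_deriv_le_mul_sqrt {J : Set ℝ} (hJ : Convex ℝ J) {f f' : ℝ → ℝ} {K R : ℝ}
    (hK : 0 < K) (hR : 0 < R) (hf : ∀ t ∈ J, 0 ≤ f t)
    (hd : ∀ t ∈ J, HasDerivWithinAt f (f' t) J t)
    (hb : ∀ t ∈ J, |f' t| ≤ K * √(f t) * f t) (h0 : (0 : ℝ) ∈ J) (hf0 : f 0 ≤ R ^ 2)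
    {t : ℝ} (ht : t ∈ J) (htK : |t| ≤ 1 / (2 * K * R)) : f t ≤ 16 * R ^ 2 := by
  -- `(f + 3 R²)^{-1/2}` is Lipschitz with constant `K / 2`
  have hR2 : 0 < R ^ 2 := by positivity
  have hpos : ∀ t ∈ J, 0 < f t + 3 * R ^ 2 := fun t ht => by linarith [hf t ht]
  have h1 : ∀ t ∈ J, HasDerivWithinAt (fun τ => (√(f τ + 3 * R ^ 2))⁻¹)
      (-(f' t / (2 * √(f t + 3 * R ^ 2))) / √(f t + 3 * R ^ 2) ^ 2) J t := fun t ht =>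
    (((hd t ht).add_const _).sqrt (hpos t ht).ne').inv (Real.sqrt_pos.2 (hpos t ht)).ne'
  have h2 := hJ.norm_image_sub_le_of_norm_hasDerivWithin_le (C := K / 2) h1 (fun t ht => by
    have hs := Real.sqrt_pos.2 (hpos t ht)
    have hsq := Real.sq_sqrt (hpos t ht).le
    have hle : √(f t) ≤ √(f t + 3 * R ^ 2) := Real.sqrt_le_sqrt (by linarith)
    rw [Real.norm_eq_abs, abs_div, abs_neg, abs_div, abs_of_pos (by positivity : 0 <
      2 * √(f t + 3 * R ^ 2)), abs_of_pos (by positivity : 0 < √(f t + 3 * R ^ 2) ^ 2),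
      div_div, div_le_iff₀ (by positivity)]
    calc |f' t| ≤ K * √(f t) * f t := hb t ht
      _ ≤ K * √(f t + 3 * R ^ 2) * (f t + 3 * R ^ 2) := by
        have := hf t ht
        gcongr
        linarith
      _ = K * √(f t + 3 * R ^ 2) * √(f t + 3 * R ^ 2) ^ 2 := by rw [hsq]
      _ = _ := by ring) h0 ht
  rw [Real.norm_eq_abs, Real.norm_eq_abs, sub_zero] at h2
  have h3 : (2 * R)⁻¹ ≤ (√(f 0 + 3 * R ^ 2))⁻¹ := by
    refine inv_anti₀ (Real.sqrt_pos.2 (hpos 0 h0)) ?_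
    rw [Real.sqrt_le_left (by positivity)]
    nlinarith
  have h4 : K / 2 * |t| ≤ (4 * R)⁻¹ := by
    calc K / 2 * |t| ≤ K / 2 * (1 / (2 * K * R)) := by gcongr
      _ = (4 * R)⁻¹ := by field_simp; norm_num
  have h5 : (2 * R)⁻¹ = 2 * (4 * R)⁻¹ := by field_simp; norm_num
  have h6 : (4 * R)⁻¹ ≤ (√(f t + 3 * R ^ 2))⁻¹ := by
    have := (abs_le.1 h2).1
    linarith
  have h7 := (inv_le_inv₀ (by positivity) (Real.sqrt_pos.2 (hpos t ht))).1 h6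
  rw [Real.sqrt_le_left (by positivity)] at h7
  nlinarith

/-! ### Energy estimates for the Galerkin approximations -/

/-- `v` is, in terms of Fourier coefficients, a solution on the time interval `J` of the
Benjamin-Ono equation projected to the frequencies `|n| ≤ N`, with values in the real
trigonometric polynomials of degree at most `N` and zero mean value. -/
structure IsGalerkin (N : ℕ) (J : Set ℝ) (v : ℝ → ℤ → ℂ) : Prop where
  trig : ∀ t ∈ J, IsRealTrig N (v t)
  deriv : ∀ t ∈ J, ∀ n : ℤ, |n| ≤ N →
    HasDerivWithinAt (fun τ => v τ n) (boField (v t) n) J t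

/-- The weighted energy `∑ w(n) |v(n)|²` of the frequencies `|n| ≤ N`. -/
noncomputable def energy (N : ℕ) (w : ℤ → ℝ) (v : ℤ → ℂ) : ℝ :=
  ∑ n ∈ modes N, w n * ‖v n‖ ^ 2

lemma energy_nonneg {N : ℕ} {w : ℤ → ℝ} (hw : ∀ n, 0 ≤ w n) (v : ℤ → ℂ) : 0 ≤ energy N w v :=
  Finset.sum_nonneg fun n _ => mul_nonneg (hw n) (by positivity)

lemma IsRealTrig.energy_eq {N M : ℕ} (h : N ≤ M) (w : ℤ → ℝ) {v : ℤ → ℂ}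
    (hv : IsRealTrig N v) : energy M w v = energy N w v :=
  (Finset.sum_subset (modes_mono h) fun n _ hn => by
    rw [hv.supp n (by simpa using hn)]; simp).symm

/-- The Sobolev weight of order two. -/
noncomputable def weightTwo (n : ℤ) : ℝ := (1 + (n : ℝ) ^ 2) ^ (2 : ℝ)

lemma weightTwo_eq (n : ℤ) : weightTwo n = (1 + (n : ℝ) ^ 2) ^ 2 :=
  Real.rpow_two _

lemma isAdmissible_weightTwo : IsAdmissible 2 weightTwo := isAdmissible_bracket (by norm_num)

/-- The constant of the embedding of `H²` into the functions whose derivative has an absolutely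
convergent Fourier series. -/
noncomputable def wienerConst : ℝ := 1 + √(∑' n : ℤ, 1 / (n : ℝ) ^ 2)

lemma wienerConst_pos : 0 < wienerConst := by unfold wienerConst; positivity

lemma sum_abs_mul_norm_le (N : ℕ) (v : ℤ → ℂ) :
    ∑ c ∈ modes N, |(c : ℝ)| * ‖v c‖ ≤ wienerConst * √(energy N weightTwo v) := by
  have h1 : ∀ c : ℤ, |(c : ℝ)| * ‖v c‖ =
      |(c : ℝ)| / (1 + (c : ℝ) ^ 2) * ((1 + (c : ℝ) ^ 2) * ‖v c‖) := fun c => by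
    have := (bracket_pos c).ne'
    field_simp
  rw [Finset.sum_congr rfl fun c _ => h1 c]
  refine (Real.sum_mul_le_sqrt_mul_sqrt _ _ _).trans ?_
  have h2 : ∑ c ∈ modes N, ((1 + (c : ℝ) ^ 2) * ‖v c‖) ^ 2 = energy N weightTwo v :=
    Finset.sum_congr rfl fun c _ => by rw [weightTwo_eq, mul_pow]
  rw [h2]
  have h3 : ∑ c ∈ modes N, (|(c : ℝ)| / (1 + (c : ℝ) ^ 2)) ^ 2 ≤ ∑' n : ℤ, 1 / (n : ℝ) ^ 2 := by
    refine (Finset.sum_le_sum fun c _ => ?_).trans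
      ((Real.summable_one_div_int_pow.2 one_lt_two).sum_le_tsum _ fun n _ => by positivity)
    rcases eq_or_ne c 0 with rfl | hc
    · simp
    · have hc' : (0 : ℝ) < (c : ℝ) ^ 2 := by positivity
      rw [div_pow, sq_abs, div_le_div_iff₀ (by positivity) hc']
      nlinarith
  gcongr
  unfold wienerConst
  linarith [Real.sqrt_le_sqrt h3]

section Estimates

variable {N : ℕ} {J : Set ℝ} {v : ℝ → ℤ → ℂ}

lemma IsGalerkin.mono_set {I : Set ℝ} (hv : IsGalerkin N J v) (h : I ⊆ J) :
    IsGalerkin N I v :=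
  ⟨fun t ht => hv.trig t (h ht), fun t ht n hn => (hv.deriv t (h ht) n hn).mono h⟩

lemma hasDerivWithinAt_energy {v' : ℤ → ℂ} {t : ℝ} (w : ℤ → ℝ)
    (h : ∀ n ∈ modes N, HasDerivWithinAt (fun τ => v τ n) (v' n) J t) :
    HasDerivWithinAt (fun τ => energy N w (v τ))
      (∑ n ∈ modes N, w n * (2 * (star (v t n) * v' n).re)) J t := by
  unfold energy
  refine HasDerivWithinAt.fun_sum fun n hn => ?_
  have := ((h n hn).norm_sq).const_mul (w n)
  rwa [Complex.inner, mul_comm (v' n)] at this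

lemma IsGalerkin.hasDerivWithinAt_energy (hv : IsGalerkin N J v) (w : ℤ → ℝ) {t : ℝ}
    (ht : t ∈ J) :
    HasDerivWithinAt (fun τ => energy N w (v τ))
      (∑ n ∈ modes N, w n * (2 * (star (v t n) * boField (v t) n).re)) J t :=
  BenjaminOno.hasDerivWithinAt_energy w fun n hn => hv.deriv t ht n (mem_modes.1 hn)

lemma abs_energy_deriv_le {p : ℝ} (hp : 1 ≤ p) {w : ℤ → ℝ} (hw : IsAdmissible p w)
    {x : ℤ → ℂ} (hx : IsRealTrig N x) :
    |∑ n ∈ modes N, w n * (2 * (star (x n) * boField x n).re)| ≤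
      symbolConst p * (wienerConst * √(energy N weightTwo x)) * energy N w x := by
  rw [sum_energy_eq hx hw]
  refine (Complex.abs_re_le_norm _).trans ((norm_triSum_energy_le hp hw x).trans ?_)
  have h1 := sum_abs_mul_norm_le N x
  have h2 := symbolConst_pos hp
  have h3 := energy_nonneg (N := N) hw.nonneg x
  change _ * _ * energy N w x ≤ _
  gcongr

/-- The time for which the `H²` norm of a solution with data of `H²` norm at most `R` is under
control. -/
noncomputable def lifetime (R : ℝ) : ℝ := 1 / (2 * (symbolConst 2 * wienerConst) * R)

lemma lifetime_pos {R : ℝ} (hR : 0 < R) : 0 < lifetime R := by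
  have := symbolConst_pos one_le_two
  have := wienerConst_pos
  unfold lifetime
  positivity

variable {R : ℝ}

lemma IsGalerkin.energy_weightTwo_le (hv : IsGalerkin N J v) (hJ : Convex ℝ J)
    (h0 : (0 : ℝ) ∈ J) (hR : 0 < R) (hJR : ∀ t ∈ J, |t| ≤ lifetime R)
    (hv0 : energy N weightTwo (v 0) ≤ R ^ 2) {t : ℝ} (ht : t ∈ J) :
    energy N weightTwo (v t) ≤ 16 * R ^ 2 := by
  have hC := symbolConst_pos one_le_two
  have hW := wienerConst_pos
  refine le_of_abs_deriv_le_mul_sqrt hJ (mul_pos hC hW) hR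
    (fun t _ => energy_nonneg isAdmissible_weightTwo.nonneg _)
    (fun t ht => hv.hasDerivWithinAt_energy weightTwo ht) (fun t ht => ?_) h0 hv0 ht (hJR t ht)
  refine (abs_energy_deriv_le one_le_two isAdmissible_weightTwo (hv.trig t ht)).trans (le_of_eq ?_)
  ring

lemma sqrt_le_of_le_sixteen {x : ℝ} (hR : 0 < R) (h : x ≤ 16 * R ^ 2) : √x ≤ 4 * R := by
  rw [Real.sqrt_le_left (by positivity)]
  linarith

/-- The growth factor of the energies of order `p` up to the time `lifetime R`. -/
noncomputable def growthConst (p R : ℝ) : ℝ :=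
  Real.exp (symbolConst p * (wienerConst * (4 * R)) * lifetime R)

/-- Propagation of the regularity given by an admissible weight, for as long as the `H²` norm is
under control. -/
lemma IsGalerkin.energy_le (hv : IsGalerkin N J v) (hJ : Convex ℝ J)
    (h0 : (0 : ℝ) ∈ J) (hR : 0 < R) (hJR : ∀ t ∈ J, |t| ≤ lifetime R)
    (hv0 : energy N weightTwo (v 0) ≤ R ^ 2) {p : ℝ} (hp : 1 ≤ p) {w : ℤ → ℝ}
    (hw : IsAdmissible p w) {t : ℝ} (ht : t ∈ J) :
    energy N w (v t) ≤ energy N w (v 0) * growthConst p R := by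
  have hC := symbolConst_pos hp
  have hW := wienerConst_pos
  have := le_mul_exp_of_abs_deriv_le hJ (K := symbolConst p * (wienerConst * (4 * R)))
    (by positivity) (fun t _ => energy_nonneg hw.nonneg _)
    (fun t ht => hv.hasDerivWithinAt_energy w ht) (fun t ht => ?_) h0 ht
  · refine this.trans ?_
    have h1 := energy_nonneg (N := N) hw.nonneg (v 0)
    unfold growthConst
    rw [sub_zero]
    have := hJR t ht
    gcongr
  · refine (abs_energy_deriv_le hp hw (hv.trig t ht)).trans ?_
    have h1 := sqrt_le_of_le_sixteen hR (hv.energy_weightTwo_le hJ h0 hR hJR hv0 ht)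
    have h2 := energy_nonneg (N := N) hw.nonneg (v t)
    gcongr

end Estimates

/-! ### The difference of two Galerkin approximations -/

lemma conv_comm_of_isRealTrig {N : ℕ} {f g : ℤ → ℂ} (hf : IsRealTrig N f)
    (hg : IsRealTrig N g) (n : ℤ) : conv f g n = conv g f n := by
  rw [conv_eq_sum hf hg, conv_eq_sum hg hf, Finset.sum_comm]
  refine Finset.sum_congr rfl fun c _ => Finset.sum_congr rfl fun b _ => ?_
  rw [add_comm b c, mul_comm]

lemma conv_sub_conv {N : ℕ} {u v : ℤ → ℂ} (hu : IsRealTrig N u) (hv : IsRealTrig N v) (n : ℤ) :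
    conv u u n - conv v v n = conv (fun n => u n - v n) (fun n => u n + v n) n := by
  have h : conv (fun n => u n - v n) (fun n => u n + v n) n =
      conv u u n + conv u v n - conv v u n - conv v v n := by
    rw [conv_eq_sum (hu.sub hv) (hu.add hv), conv_eq_sum hu hu, conv_eq_sum hu hv,
      conv_eq_sum hv hu, conv_eq_sum hv hv]
    simp only [← Finset.sum_add_distrib, ← Finset.sum_sub_distrib]
    refine Finset.sum_congr rfl fun b _ => Finset.sum_congr rfl fun c _ => ?_
    split_ifs
    · ring
    · ring
  rw [h, conv_comm_of_isRealTrig hu hv]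
  ring

/-- The energy identity for the difference of a Galerkin approximation and of one of lower
degree `N`. -/
lemma sum_difference_eq {N M : ℕ} {u v : ℤ → ℂ} (hNM : N ≤ M) (hu : IsRealTrig M u)
    (hv : IsRealTrig N v) :
    ∑ n ∈ modes M, (1 : ℝ) * (2 * (star (u n - v n) *
        (boField u n - if |n| ≤ (N : ℤ) then boField v n else 0)).re) =
      (triSum (modes M) fun a b c =>
        Complex.I * a * ((u a - v a) * (u b - v b) * (u c + v c))).re +
      (triSum (modes M) fun a b c => (if |a| ≤ (N : ℤ) then 0 else Complex.I * a) *
        ((u a - v a) * v b * v c)).re := by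
  have hvM := hv.mono hNM
  have hz := hu.sub hvM
  have e1 := sum_pairing_conv hz hz (hu.add hvM) (fun n => -(Complex.I * n))
  have e2 := sum_pairing_conv hz hvM hvM (fun n => if |n| ≤ (N : ℤ) then 0 else -(Complex.I * n))
  have e1' : (triSum (modes M) fun a b c =>
      Complex.I * a * ((u a - v a) * (u b - v b) * (u c + v c))) = triSum (modes M) fun a b c =>
      -(Complex.I * ((-a : ℤ) : ℂ)) * ((u a - v a) * (u b - v b) * (u c + v c)) :=
    triSum_congr fun a b c _ => by push_cast; ring
  have e2' : (triSum (modes M) fun a b c => (if |a| ≤ (N : ℤ) then 0 else Complex.I * a) *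
        ((u a - v a) * v b * v c)) = triSum (modes M) fun a b c =>
      (if |-a| ≤ (N : ℤ) then 0 else -(Complex.I * ((-a : ℤ) : ℂ))) *
        ((u a - v a) * v b * v c) :=
    triSum_congr fun a b c _ => by rw [abs_neg]; push_cast; ring_nf
  rw [e1', e2', ← e1, ← e2, ← Complex.add_re, ← Finset.sum_add_distrib, Complex.re_sum]
  refine Finset.sum_congr rfl fun n _ => ?_
  rw [← conv_sub_conv hu hvM]
  have h1 : boField u n - (if |n| ≤ (N : ℤ) then boField v n else 0) =
      -(Complex.I * (Int.sign n : ℂ) * (n : ℂ) ^ 2 * (u n - v n)) -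
      Complex.I * n / 2 * (conv u u n - conv v v n) +
      (if |n| ≤ (N : ℤ) then 0 else -(Complex.I * n)) / 2 * conv v v n := by
    unfold boField
    split_ifs with h
    · ring
    · rw [hv.supp n h]; ring
  rw [h1]
  have h2 : star (u n - v n) * (-(Complex.I * (Int.sign n : ℂ) * (n : ℂ) ^ 2 * (u n - v n)) -
      Complex.I * n / 2 * (conv u u n - conv v v n) +
      (if |n| ≤ (N : ℤ) then 0 else -(Complex.I * n)) / 2 * conv v v n) =
      -(((Int.sign n * n ^ 2 * Complex.normSq (u n - v n) : ℝ) : ℂ) * Complex.I) +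
      ((1 / 2 : ℝ) : ℂ) * (-(Complex.I * n) * (star (u n - v n) * (conv u u n - conv v v n)) +
      (if |n| ≤ (N : ℤ) then 0 else -(Complex.I * n)) * (star (u n - v n) * conv v v n)) := by
    push_cast
    rw [Complex.normSq_eq_conj_mul_self]
    simp only [Complex.star_def]
    ring
  rw [h2, Complex.add_re, Complex.neg_re, Complex.re_ofReal_mul, Complex.I_re,
    Complex.re_ofReal_mul]
  ring

/-- The constant of the `L²` estimate of the difference of two Galerkin approximations. -/
noncomputable def diffConst (R : ℝ) : ℝ :=
  9 * R ^ 2 * Real.exp (16 * wienerConst * R * lifetime R)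

/-- Galerkin approximations with the same data differ in `L²` by `O(N^{-1/2})`. -/
lemma sum_sq_difference_le {N M : ℕ} (hN : 0 < N) (hNM : N ≤ M) {J : Set ℝ}
    {u v : ℝ → ℤ → ℂ} (hu : IsGalerkin M J u) (hv : IsGalerkin N J v) (hJ : Convex ℝ J)
    (h0 : (0 : ℝ) ∈ J) {R : ℝ} (hR : 0 < R) (hJR : ∀ t ∈ J, |t| ≤ lifetime R)
    (hu0 : energy M weightTwo (u 0) ≤ R ^ 2) (huv : ∀ n : ℤ, |n| ≤ N → u 0 n = v 0 n)
    {t : ℝ} (ht : t ∈ J) :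
    ∑ n ∈ modes M, ‖u t n - v t n‖ ^ 2 ≤ diffConst R / N := by
  have hN' : (1 : ℝ) ≤ N := by exact_mod_cast hN
  have hN0 : (0 : ℝ) < N := by linarith
  have hW := wienerConst_pos
  have hv0 : energy N weightTwo (v 0) ≤ R ^ 2 := by
    refine le_trans ?_ hu0
    have : energy N weightTwo (v 0) = energy N weightTwo (u 0) :=
      Finset.sum_congr rfl fun n hn => by rw [huv n (mem_modes.1 hn)]
    rw [this]
    exact Finset.sum_le_sum_of_subset_of_nonneg (modes_mono hNM) fun n _ _ =>
      mul_nonneg (isAdmissible_weightTwo.nonneg n) (by positivity)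
  have hd : ∀ t ∈ J, HasDerivWithinAt (fun τ => energy M (fun _ => 1) (fun n => u τ n - v τ n))
      (∑ n ∈ modes M, (1 : ℝ) * (2 * (star (u t n - v t n) *
        (boField (u t) n - if |n| ≤ (N : ℤ) then boField (v t) n else 0)).re)) J t := by
    intro t ht
    refine hasDerivWithinAt_energy (v := fun τ n => u τ n - v τ n) _ fun n hn => ?_
    refine (hu.deriv t ht n (mem_modes.1 hn)).sub ?_
    split_ifs with h
    · exact hv.deriv t ht n h
    · exact (hasDerivWithinAt_const t J (0 : ℂ)).congr (fun τ hτ => (hv.trig τ hτ).supp n h)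
        ((hv.trig t ht).supp n h)
  have hb : ∀ t ∈ J, |∑ n ∈ modes M, (1 : ℝ) * (2 * (star (u t n - v t n) *
        (boField (u t) n - if |n| ≤ (N : ℤ) then boField (v t) n else 0)).re)| ≤
      16 * wienerConst * R * (energy M (fun _ => 1) (fun n => u t n - v t n) + 8 * R ^ 2 / N) := by
    intro t ht
    have hut := hu.trig t ht
    have hvt := hv.trig t ht
    have hu2 := hu.energy_weightTwo_le hJ h0 hR hJR hu0 ht
    have hv2 := hv.energy_weightTwo_le hJ h0 hR hJR hv0 ht
    rw [← hvt.energy_eq hNM] at hv2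
    have hXu : ∑ c ∈ modes M, |(c : ℝ)| * ‖u t c‖ ≤ wienerConst * (4 * R) :=
      (sum_abs_mul_norm_le M (u t)).trans (by gcongr; exact sqrt_le_of_le_sixteen hR hu2)
    have hXv : ∑ c ∈ modes M, |(c : ℝ)| * ‖v t c‖ ≤ wienerConst * (4 * R) :=
      (sum_abs_mul_norm_le M (v t)).trans (by gcongr; exact sqrt_le_of_le_sixteen hR hv2)
    have hX : ∑ c ∈ modes M, |(c : ℝ)| * ‖u t c + v t c‖ ≤ wienerConst * (8 * R) := by
      calc _ ≤ ∑ c ∈ modes M, (|(c : ℝ)| * ‖u t c‖ + |(c : ℝ)| * ‖v t c‖) :=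
            Finset.sum_le_sum fun c _ => by
              rw [← mul_add]; gcongr; exact norm_add_le _ _
        _ ≤ _ := by rw [Finset.sum_add_distrib]; linarith
    have hY : ∑ c ∈ modes M, ‖v t c‖ ≤ wienerConst * (4 * R) := by
      refine le_trans (Finset.sum_le_sum fun c _ => ?_) hXv
      rcases eq_or_ne c 0 with rfl | hc
      · simp [hvt.zero]
      · have : (1 : ℝ) ≤ |(c : ℝ)| := by exact_mod_cast Int.one_le_abs hc
        exact le_mul_of_one_le_left (norm_nonneg _) this
    have hZ : ∑ b ∈ modes M, (b : ℝ) ^ 4 * ‖v t b‖ ^ 2 ≤ 16 * R ^ 2 := by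
      refine le_trans (Finset.sum_le_sum fun c _ => ?_) hv2
      rw [weightTwo_eq]
      gcongr
      nlinarith [sq_nonneg (c : ℝ)]
    have hE : energy M (fun _ => 1) (fun n => u t n - v t n) =
        ∑ n ∈ modes M, ‖u t n - v t n‖ ^ 2 := by simp [energy]
    rw [sum_difference_eq hNM hut hvt, hE]
    set f := ∑ n ∈ modes M, ‖u t n - v t n‖ ^ 2 with hf
    have hf0 : 0 ≤ f := Finset.sum_nonneg fun n _ => by positivity
    have b1 := norm_triSum_difference_le (S := modes M) (fun n => u t n - v t n)
      (fun n => u t n + v t n)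
    have b2 := norm_triSum_high_le (S := modes M) hN (fun n => u t n - v t n) (v t)
    have c1 : (∑ c ∈ modes M, |(c : ℝ)| * ‖u t c + v t c‖) * f ≤ wienerConst * (8 * R) * f := by
      gcongr
    have c2 : 2 / N * (∑ c ∈ modes M, ‖v t c‖) * (f + ∑ b ∈ modes M, (b : ℝ) ^ 4 * ‖v t b‖ ^ 2) ≤
        2 / N * (wienerConst * (4 * R)) * (f + 16 * R ^ 2) := by
      gcongr
    have c3 : 2 / N * (wienerConst * (4 * R)) * (f + 16 * R ^ 2) ≤
        8 * wienerConst * R * f + 16 * wienerConst * R * (8 * R ^ 2 / N) := by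
      have : 2 / N * (wienerConst * (4 * R)) * (f + 16 * R ^ 2) =
        8 * wienerConst * R * f * (1 / N) + 16 * wienerConst * R * (8 * R ^ 2 / N) := by
        field_simp; ring
      rw [this]
      have h1N : 1 / (N : ℝ) ≤ 1 := by rw [div_le_one hN0]; exact hN'
      have : 8 * wienerConst * R * f * (1 / N) ≤ 8 * wienerConst * R * f :=
        mul_le_of_le_one_right (by positivity) h1N
      linarith
    refine (abs_add_le _ _).trans ?_
    have r1 := (Complex.abs_re_le_norm _).trans b1
    have r2 := (Complex.abs_re_le_norm _).trans b2
    calc _ ≤ wienerConst * (8 * R) * f + 2 / N * (wienerConst * (4 * R)) * (f + 16 * R ^ 2) :=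
          add_le_add (r1.trans c1) (r2.trans c2)
      _ ≤ _ := by linarith
  have h1 := add_le_mul_exp_of_abs_deriv_le hJ (δ := 8 * R ^ 2 / N) (by positivity)
    (fun t _ => energy_nonneg (fun _ => zero_le_one) _) hd hb h0 ht
  have h2 : energy M (fun _ => 1) (fun n => u 0 n - v 0 n) ≤ R ^ 2 / N := by
    rw [le_div_iff₀ hN0, mul_comm]
    refine le_trans ?_ hu0
    unfold energy
    rw [Finset.mul_sum]
    refine Finset.sum_le_sum fun n _ => ?_
    change (N : ℝ) * (1 * ‖u 0 n - v 0 n‖ ^ 2) ≤ weightTwo n * ‖u 0 n‖ ^ 2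
    rw [one_mul]
    by_cases h : |n| ≤ (N : ℤ)
    · rw [huv n h, sub_self, norm_zero]
      simpa using mul_nonneg (isAdmissible_weightTwo.nonneg n) (by positivity)
    · rw [(hv.trig 0 h0).supp n h, sub_zero, weightTwo_eq]
      have hn : (N : ℝ) ≤ |(n : ℝ)| := by exact_mod_cast (not_le.1 h).le
      gcongr
      have := sq_abs (n : ℝ)
      nlinarith
  have h3 : energy M (fun _ => 1) (fun n => u t n - v t n) =
        ∑ n ∈ modes M, ‖u t n - v t n‖ ^ 2 := by simp [energy]
  rw [h3] at h1
  have h4 : Real.exp (16 * wienerConst * R * |t - 0|) ≤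
      Real.exp (16 * wienerConst * R * lifetime R) := by
    rw [sub_zero]
    have := hJR t ht
    gcongr
  calc _ ≤ ∑ n ∈ modes M, ‖u t n - v t n‖ ^ 2 + 8 * R ^ 2 / N := by
        have : 0 ≤ 8 * R ^ 2 / N := by positivity
        linarith
    _ ≤ (R ^ 2 / N + 8 * R ^ 2 / N) * Real.exp (16 * wienerConst * R * lifetime R) := by
        refine h1.trans ?_
        gcongr
    _ = _ := by unfold diffConst; ring

/-! ### Existence of the Galerkin approximations -/

lemma boField_neg {N : ℕ} {v : ℤ → ℂ} (hv : IsRealTrig N v) (n : ℤ) :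
    boField v (-n) = star (boField v n) := by
  have h : conv v v (-n) = star (conv v v n) := by
    rw [conv_eq_sum hv hv, conv_eq_sum hv hv, ← sum_modes_neg, star_sum]
    refine Finset.sum_congr rfl fun b _ => ?_
    rw [← sum_modes_neg, star_sum]
    refine Finset.sum_congr rfl fun c _ => ?_
    have : -b + -c = -n ↔ b + c = n := by omega
    simp only [this]
    split_ifs
    · rw [hv.conj, hv.conj, star_mul']
    · simp
  unfold boField
  rw [h, hv.conj]
  simp only [Complex.star_def, map_sub, map_neg, map_mul, map_div₀, map_pow, Complex.conj_I,
    map_intCast, map_ofNat, Int.sign_neg, Int.cast_neg]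
  ring

lemma boField_zero (v : ℤ → ℂ) : boField v 0 = 0 := by simp [boField]

/-- The coefficients of positive frequency, which parametrise the real trigonometric polynomials
of degree at most `N` and zero mean value. -/
abbrev HalfModes (N : ℕ) : Type := Finset.Icc (1 : ℤ) N → ℂ

/-- The `n`-th coefficient of the real trigonometric polynomial given by its coefficients of
positive frequency. -/
noncomputable def extend (N : ℕ) (n : ℤ) : HalfModes N →L[ℝ] ℂ :=
  if h : n ∈ Finset.Icc (1 : ℤ) N then ContinuousLinearMap.proj ⟨n, h⟩
  else if h : -n ∈ Finset.Icc (1 : ℤ) N then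
    (Complex.conjCLE : ℂ →L[ℝ] ℂ).comp (ContinuousLinearMap.proj ⟨-n, h⟩)
  else 0

lemma extend_of_mem {N : ℕ} (x : HalfModes N) (n : Finset.Icc (1 : ℤ) N) :
    extend N n x = x n := by
  unfold extend
  rw [dif_pos n.2]
  rfl

lemma isRealTrig_extend {N : ℕ} (x : HalfModes N) : IsRealTrig N fun n => extend N n x where
  conj n := by
    unfold extend
    by_cases h1 : n ∈ Finset.Icc (1 : ℤ) N
    · have h2 : -n ∉ Finset.Icc (1 : ℤ) N := by simp at h1 ⊢; omega
      have h3 : - -n ∈ Finset.Icc (1 : ℤ) N := by rwa [neg_neg]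
      rw [dif_pos h1, dif_neg h2, dif_pos h3]
      simp
    · by_cases h2 : -n ∈ Finset.Icc (1 : ℤ) N
      · rw [dif_pos h2, dif_neg h1, dif_pos h2]
        simp
      · have h3 : - -n ∉ Finset.Icc (1 : ℤ) N := by rwa [neg_neg]
        rw [dif_neg h1, dif_neg h2, dif_neg h2, dif_neg h3]
        simp
  zero := by simp [extend]
  supp n hn := by
    have h1 : n ∉ Finset.Icc (1 : ℤ) N := by
      simp only [Finset.mem_Icc]; rw [abs_le] at hn; omega
    have h2 : -n ∉ Finset.Icc (1 : ℤ) N := by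
      simp only [Finset.mem_Icc]; rw [abs_le] at hn; omega
    simp [extend, h1, h2]

lemma IsRealTrig.extend_eq {N : ℕ} {v : ℤ → ℂ} (hv : IsRealTrig N v) (n : ℤ) :
    extend N n (fun k : Finset.Icc (1 : ℤ) N => v k) = v n := by
  unfold extend
  split_ifs with h1 h2
  · rfl
  · simp [hv.conj]
  · rcases eq_or_ne n 0 with rfl | hn
    · simp [hv.zero]
    · rw [hv.supp n]
      · simp
      · simp only [Finset.mem_Icc] at h1 h2
        rw [abs_le]
        omega

/-- The vector field of the Galerkin approximation in the variables `HalfModes N`. -/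
noncomputable def galerkinField (N : ℕ) (x : HalfModes N) : HalfModes N :=
  fun n => boField (fun k => extend N k x) n

lemma extend_galerkinField {N : ℕ} (x : HalfModes N) {n : ℤ} (hn : |n| ≤ N) :
    extend N n (galerkinField N x) = boField (fun k => extend N k x) n := by
  have hx := isRealTrig_extend x
  have hz := isRealTrig_extend (galerkinField N x)
  by_cases h1 : n ∈ Finset.Icc (1 : ℤ) N
  · exact extend_of_mem _ ⟨n, h1⟩
  by_cases h2 : -n ∈ Finset.Icc (1 : ℤ) N
  · have h3 : extend N (-n) (galerkinField N x) = boField (fun k => extend N k x) (-n) :=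
      extend_of_mem _ ⟨-n, h2⟩
    have h4 := hz.conj (-n)
    rw [neg_neg] at h4
    rw [h4, h3, boField_neg hx, star_star]
  · have : n = 0 := by
      simp only [Finset.mem_Icc] at h1 h2
      rw [abs_le] at hn
      omega
    rw [this, hz.zero, boField_zero]

lemma contDiff_galerkinField (N : ℕ) : ContDiff ℝ 1 (galerkinField N) := by
  rw [contDiff_pi]
  intro n
  unfold galerkinField boField
  simp only [conv_eq_sum (isRealTrig_extend _) (isRealTrig_extend _)]
  have h : ∀ k, ContDiff ℝ 1 fun x : HalfModes N => extend N k x := fun k =>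
    (extend N k).contDiff
  refine ((contDiff_const.mul (h _)).neg).sub (contDiff_const.mul ?_)
  refine ContDiff.sum fun b _ => ContDiff.sum fun c _ => ?_
  split_ifs
  · exact (h b).mul (h c)
  · exact contDiff_const

/-- Conservation of the `L²` norm. -/
lemma sum_re_star_mul_boField {N : ℕ} {v : ℤ → ℂ} (hv : IsRealTrig N v) :
    ∑ n ∈ modes N, (1 : ℝ) * (2 * (star (v n) * boField v n).re) = 0 := by
  have hw : IsAdmissible 0 fun _ => 1 :=
    ⟨fun _ => zero_le_one, fun _ _ _ => le_rfl, fun a b _ => by simp⟩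
  have h3 := three_mul_triSum_energy (S := modes N) (fun _ => 1) v
  have h0 : (triSum (modes N) fun a b c =>
      Complex.I * ((a * 1 + b * 1 + c * 1 : ℝ) : ℂ) * (v a * v b * v c)) = 0 := by
    rw [triSum_congr (g := fun _ _ _ => 0) fun a b c h => ?_]
    · simp [triSum]
    · have : (a : ℝ) * 1 + b * 1 + c * 1 = 0 := by
        simp only [mul_one]; exact_mod_cast h
      rw [this]; simp
  rw [h0] at h3
  rw [sum_energy_eq hv hw, (mul_eq_zero.1 h3).resolve_left (by norm_num), Complex.zero_re]

/-- The Galerkin approximations are global in time, since the `L²` norm is conserved. -/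
theorem exists_isGalerkin {N : ℕ} {y : ℤ → ℂ} (hy : IsRealTrig N y) {T : ℝ} (hT : 0 < T) :
    ∃ v, IsGalerkin N (Set.Icc (-T) T) v ∧ ∀ n, v 0 n = y n := by
  -- The field is cut off outside of a ball which the conservation law does not allow to leave.
  -- The cut-off preserves the conservation law.
  set E₀ := energy N (fun _ => 1) y with hE₀
  let φ : ContDiffBump (0 : HalfModes N) :=
    ⟨√E₀ + 1, √E₀ + 2, by positivity, by linarith⟩
  let G : HalfModes N → HalfModes N := fun x => φ x • galerkinField N x
  have hGs : HasCompactSupport G := φ.hasCompactSupport.smul_right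
  have hG : ContDiff ℝ 1 G := φ.contDiff.smul (contDiff_galerkinField N)
  obtain ⟨K, hK⟩ := ContDiff.lipschitzWith_of_hasCompactSupport hGs hG one_ne_zero
  obtain ⟨L, hL⟩ := hGs.exists_bound_of_continuous hG.continuous
  have hT0 : (0 : ℝ) ∈ Set.Icc (-T) T := ⟨by linarith, hT.le⟩
  have hPL : IsPicardLindelof (fun _ => G) (⟨0, hT0⟩ : Set.Icc (-T) T) (fun k => y k)
      (L.toNNReal * T.toNNReal) 0 L.toNNReal K := by
    refine IsPicardLindelof.of_time_independent (fun x _ => (hL x).trans ?_) hK.lipschitzOnWith ?_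
    · exact Real.le_coe_toNNReal L
    · simp [hT.le]
  obtain ⟨α, hα0, hα⟩ := hPL.exists_eq_forall_mem_Icc_hasDerivWithinAt₀
  let v : ℝ → ℤ → ℂ := fun t n => extend N n (α t)
  have hv : ∀ t, IsRealTrig N (v t) := fun t => isRealTrig_extend _
  have hd : ∀ t ∈ Set.Icc (-T) T, ∀ n : ℤ, |n| ≤ N →
      HasDerivWithinAt (fun τ => v τ n) (φ (α t) • boField (v t) n) (Set.Icc (-T) T) t := by
    intro t ht n hn
    have h1 := (extend N n).hasFDerivAt.comp_hasDerivWithinAt t (hα t ht)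
    simp only [G, map_smul, extend_galerkinField _ hn] at h1
    exact h1
  have hv0 : ∀ n, v 0 n = y n := fun n => by
    change extend N n (α 0) = y n
    rw [show α 0 = fun k : Finset.Icc (1 : ℤ) N => y k from hα0, hy.extend_eq]
  have hcons : ∀ t ∈ Set.Icc (-T) T, energy N (fun _ => 1) (v t) = E₀ := by
    intro t ht
    have hE : ∀ t ∈ Set.Icc (-T) T, HasDerivWithinAt (fun τ => energy N (fun _ => 1) (v τ)) 0
        (Set.Icc (-T) T) t := by
      intro t ht
      have h1 := hasDerivWithinAt_energy (v := v) (fun _ => 1)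
        (fun n hn => hd t ht n (mem_modes.1 hn))
      have h2 : ∑ n ∈ modes N, (1 : ℝ) * (2 * (star (v t n) * (φ (α t) • boField (v t) n)).re) =
          0 := by
        rw [← mul_zero (φ (α t)), ← sum_re_star_mul_boField (hv t), Finset.mul_sum]
        refine Finset.sum_congr rfl fun n _ => ?_
        rw [mul_smul_comm, Complex.smul_re, smul_eq_mul]
        ring
      rwa [h2] at h1
    have h2 := (convex_Icc (-T) T).norm_image_sub_le_of_norm_hasDerivWithin_le (C := 0) hE
      (fun _ _ => by simp) hT0 ht
    have h3 : energy N (fun _ => 1) (v t) = energy N (fun _ => 1) (v 0) := by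
      rw [zero_mul] at h2
      exact sub_eq_zero.1 (norm_le_zero_iff.1 h2)
    rw [h3, hE₀]
    exact Finset.sum_congr rfl fun n _ => by rw [hv0]
  refine ⟨v, ⟨fun t _ => hv t, fun t ht n hn => ?_⟩, hv0⟩
  have h1 : φ (α t) = 1 := by
    refine φ.one_of_mem_closedBall ?_
    rw [mem_closedBall_zero_iff]
    refine le_trans ?_ (le_add_of_nonneg_right zero_le_one : √E₀ ≤ √E₀ + 1)
    rw [pi_norm_le_iff_of_nonneg (Real.sqrt_nonneg _)]
    intro k
    have hk : (k : ℤ) ∈ modes N := by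
      have := Finset.mem_Icc.1 k.2
      rw [mem_modes, abs_le]
      omega
    refine Real.le_sqrt_of_sq_le ?_
    rw [← hcons t ht, ← extend_of_mem (α t) k]
    have := Finset.single_le_sum (f := fun n => (1 : ℝ) * ‖v t n‖ ^ 2)
      (fun n _ => by positivity) hk
    exact (one_mul _).symm.trans_le this
  have h2 := hd t ht n hn
  rwa [h1, one_smul] at h2

/-! ### Convolutions of square summable sequences -/

/-- The `ℓ²` norm of `f` is at most `A`. -/
def SqBound (A : ℝ) (f : ℤ → ℂ) : Prop := ∀ S : Finset ℤ, ∑ n ∈ S, ‖f n‖ ^ 2 ≤ A ^ 2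

lemma sum_norm_mul_shift_le {A B : ℝ} (hA : 0 ≤ A) (hB : 0 ≤ B) {f g : ℤ → ℂ}
    (hf : SqBound A f) (hg : SqBound B g) (n : ℤ) (S : Finset ℤ) :
    ∑ b ∈ S, ‖f b * g (n - b)‖ ≤ A * B := by
  simp only [norm_mul]
  refine (Real.sum_mul_le_sqrt_mul_sqrt _ _ _).trans ?_
  refine mul_le_mul ?_ ?_ (Real.sqrt_nonneg _) hA
  · exact (Real.sqrt_le_left hA).2 (hf S)
  · refine (Real.sqrt_le_left hB).2 ?_
    have := hg (S.map (Equiv.subLeft n).toEmbedding)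
    rwa [Finset.sum_map] at this

lemma summable_mul_shift {A B : ℝ} (hA : 0 ≤ A) (hB : 0 ≤ B) {f g : ℤ → ℂ}
    (hf : SqBound A f) (hg : SqBound B g) (n : ℤ) : Summable fun b => f b * g (n - b) :=
  Summable.of_norm (summable_of_sum_le (fun _ => norm_nonneg _)
    (sum_norm_mul_shift_le hA hB hf hg n))

lemma norm_conv_le {A B : ℝ} (hA : 0 ≤ A) (hB : 0 ≤ B) {f g : ℤ → ℂ}
    (hf : SqBound A f) (hg : SqBound B g) (n : ℤ) : ‖conv f g n‖ ≤ A * B := by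
  have h := sum_norm_mul_shift_le hA hB hf hg n
  exact (norm_tsum_le_tsum_norm (summable_of_sum_le (fun _ => norm_nonneg _) h)).trans
    (Real.tsum_le_of_sum_le (fun _ => norm_nonneg _) h)

lemma norm_conv_sub_conv_le {A δ : ℝ} (hA : 0 ≤ A) (hδ : 0 ≤ δ) {f g : ℤ → ℂ}
    (hf : SqBound A f) (hg : SqBound A g) (hfg : SqBound δ fun n => f n - g n) (n : ℤ) :
    ‖conv f f n - conv g g n‖ ≤ 2 * A * δ := by
  have e : conv f f n - conv g g n =
      conv (fun n => f n - g n) f n + conv g (fun n => f n - g n) n := by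
    unfold conv
    rw [← (summable_mul_shift hA hA hf hf n).tsum_sub (summable_mul_shift hA hA hg hg n),
      ← (summable_mul_shift hδ hA hfg hf n).tsum_add (summable_mul_shift hA hδ hg hfg n)]
    exact tsum_congr fun b => by ring
  rw [e]
  refine (norm_add_le _ _).trans ?_
  have h1 := norm_conv_le hδ hA hfg hf n
  have h2 := norm_conv_le hA hδ hg hfg n
  linarith

lemma abs_sign_le_one (n : ℤ) : |((Int.sign n : ℤ) : ℝ)| ≤ 1 := by
  rcases lt_trichotomy n 0 with h | h | h
  · simp [Int.sign_eq_neg_one_of_neg h]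
  · simp [h]
  · simp [Int.sign_eq_one_of_pos h]

lemma norm_boField_sub_le {A δ : ℝ} (hA : 0 ≤ A) (hδ : 0 ≤ δ) {f g : ℤ → ℂ}
    (hf : SqBound A f) (hg : SqBound A g) (hfg : SqBound δ fun n => f n - g n) (n : ℤ) :
    ‖boField f n - boField g n‖ ≤ ((n : ℝ) ^ 2 + |(n : ℝ)| * A) * δ := by
  have e : boField f n - boField g n =
      -(Complex.I * (Int.sign n : ℂ) * (n : ℂ) ^ 2 * (f n - g n)) -
        Complex.I * n / 2 * (conv f f n - conv g g n) := by
    unfold boField; ring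
  have h1 : ‖f n - g n‖ ≤ δ := by
    have := hfg {n}
    rw [Finset.sum_singleton] at this
    exact (pow_le_pow_iff_left₀ (norm_nonneg _) hδ two_ne_zero).1 this
  have h2 := norm_conv_sub_conv_le hA hδ hf hg hfg n
  have hs : |((Int.sign n : ℤ) : ℝ)| ≤ 1 := abs_sign_le_one n
  rw [e]
  refine (norm_sub_le _ _).trans ?_
  simp only [norm_neg, norm_mul, norm_div, norm_pow, Complex.norm_I, one_mul,
    Complex.norm_intCast, Complex.norm_ofNat, sq_abs]
  calc _ ≤ 1 * (n : ℝ) ^ 2 * δ + |(n : ℝ)| / 2 * (2 * A * δ) := by gcongr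
    _ = _ := by ring

/-! ### Passage to the limit in the Galerkin approximations -/

/-- The truncation of a sequence to the frequencies `|n| ≤ N`. -/
noncomputable def truncate (N : ℕ) (x : ℤ → ℂ) (n : ℤ) : ℂ := if |n| ≤ (N : ℤ) then x n else 0

lemma isRealTrig_truncate {x : ℤ → ℂ} (hx : ∀ n, x (-n) = star (x n)) (hx0 : x 0 = 0) (N : ℕ) :
    IsRealTrig N (truncate N x) where
  conj n := by unfold truncate; rw [abs_neg]; split_ifs <;> simp [hx]
  zero := by simp [truncate, hx0]
  supp n hn := by simp [truncate, hn]

lemma energy_truncate_le {x : ℤ → ℂ} {w : ℤ → ℝ} (hw : ∀ n, 0 ≤ w n)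
    (hs : Summable fun n => w n * ‖x n‖ ^ 2) (N : ℕ) :
    energy N w (truncate N x) ≤ ∑' n, w n * ‖x n‖ ^ 2 := by
  have : energy N w (truncate N x) = ∑ n ∈ modes N, w n * ‖x n‖ ^ 2 :=
    Finset.sum_congr rfl fun n hn => by rw [truncate, if_pos (mem_modes.1 hn)]
  rw [this]
  exact hs.sum_le_tsum _ fun n _ => mul_nonneg (hw n) (by positivity)

lemma eventually_subset_modes (S : Finset ℤ) : ∀ᶠ k : ℕ in atTop, S ⊆ modes (k + 1) := by
  have h : ∀ᶠ k : ℕ in atTop, ∀ n ∈ S, n ∈ modes (k + 1) := by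
    rw [eventually_all_finset]
    intro n _
    filter_upwards [eventually_ge_atTop n.natAbs] with k hk
    rw [mem_modes, abs_le]
    push_cast
    omega
  exact h

section Limit

variable {x : ℤ → ℂ} {R : ℝ} {V : ℕ → ℝ → ℤ → ℂ} {u : ℝ → ℤ → ℂ}

/-- `u` is the limit on the time interval `[-lifetime R, lifetime R]` of the Galerkin
approximations `V k`, of degree `k + 1`, all of them with the datum `x`. -/
structure IsGalerkinLimit (x : ℤ → ℂ) (R : ℝ) (V : ℕ → ℝ → ℤ → ℂ) (u : ℝ → ℤ → ℂ) : Prop where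
  radius_pos : 0 < R
  datum_conj : ∀ n, x (-n) = star (x n)
  datum_zero : x 0 = 0
  datum_summable : Summable fun n => weightTwo n * ‖x n‖ ^ 2
  datum_le : ∑' n, weightTwo n * ‖x n‖ ^ 2 ≤ R ^ 2
  galerkin : ∀ k, IsGalerkin (k + 1) (Set.Icc (-lifetime R) (lifetime R)) (V k)
  initial : ∀ k n, V k 0 n = truncate (k + 1) x n
  tendsto : ∀ t ∈ Set.Icc (-lifetime R) (lifetime R), ∀ n,
    Tendsto (fun k => V k t n) atTop (𝓝 (u t n))

lemma energy_truncate_weightTwo_le (hs : Summable fun n => weightTwo n * ‖x n‖ ^ 2)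
    (hx : ∑' n, weightTwo n * ‖x n‖ ^ 2 ≤ R ^ 2) {N : ℕ} {v : ℤ → ℂ}
    (hv : ∀ n, v n = truncate N x n) : energy N weightTwo v ≤ R ^ 2 := by
  rw [show v = truncate N x from funext hv]
  exact (energy_truncate_le isAdmissible_weightTwo.nonneg hs N).trans hx

lemma exists_isGalerkinLimit (hR : 0 < R) (hx : ∀ n, x (-n) = star (x n)) (hx0 : x 0 = 0)
    (hs : Summable fun n => weightTwo n * ‖x n‖ ^ 2)
    (hxR : ∑' n, weightTwo n * ‖x n‖ ^ 2 ≤ R ^ 2) : ∃ V u, IsGalerkinLimit x R V u := by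
  have hT := lifetime_pos hR
  set J := Set.Icc (-lifetime R) (lifetime R) with hJ
  have h0 : (0 : ℝ) ∈ J := ⟨by linarith, hT.le⟩
  choose V hV hV0 using fun k : ℕ =>
    exists_isGalerkin (isRealTrig_truncate hx hx0 (k + 1)) hT
  have hlim : ∀ t n, ∃ l, t ∈ J → Tendsto (fun k => V k t n) atTop (𝓝 l) := by
    intro t n
    by_cases ht : t ∈ J
    · have hC : CauchySeq fun k => V k t n := by
        refine cauchySeq_of_le_tendsto_0' (fun k => √(diffConst R / (k + 1 : ℕ)))
          (fun k m hkm => ?_) ?_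
        · have h1 := sum_sq_difference_le k.succ_pos (Nat.succ_le_succ hkm) (hV m) (hV k)
            (convex_Icc _ _) h0 hR (fun t ht => abs_le.2 ht)
            (energy_truncate_weightTwo_le hs hxR (hV0 m)) (fun n hn => by
              rw [hV0, hV0, truncate, truncate, if_pos hn,
                if_pos (hn.trans (by exact_mod_cast Nat.succ_le_succ hkm))]) ht
          rw [dist_comm, dist_eq_norm]
          refine Real.le_sqrt_of_sq_le (le_trans ?_ h1)
          by_cases hn : n ∈ modes (m + 1)
          · exact Finset.single_le_sum (f := fun n => ‖V m t n - V k t n‖ ^ 2)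
              (fun n _ => by positivity) hn
          · have hn' : ¬ |n| ≤ ((k + 1 : ℕ) : ℤ) := fun h =>
              hn (modes_mono (Nat.succ_le_succ hkm) (mem_modes.2 h))
            rw [((hV m).trig t ht).supp n (by simpa using hn), ((hV k).trig t ht).supp n hn']
            simpa using Finset.sum_nonneg fun n _ => by positivity
        · rw [← Real.sqrt_zero]
          refine Tendsto.sqrt ?_
          exact (tendsto_const_div_atTop_nhds_zero_nat (diffConst R)).comp
            (tendsto_add_atTop_nat 1)
      obtain ⟨l, hl⟩ := cauchySeq_tendsto_of_complete hC
      exact ⟨l, fun _ => hl⟩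
    · exact ⟨0, fun h => absurd h ht⟩
  choose u hu using hlim
  exact ⟨V, u, hR, hx, hx0, hs, hxR, hV, hV0, fun t ht n => hu t n ht⟩

namespace IsGalerkinLimit

variable (h : IsGalerkinLimit x R V u)
include h

lemma zero_mem : (0 : ℝ) ∈ Set.Icc (-lifetime R) (lifetime R) := by
  have := lifetime_pos h.radius_pos
  exact ⟨by linarith, this.le⟩

lemma initial_eq (n : ℤ) : u 0 n = x n := by
  refine tendsto_nhds_unique (h.tendsto 0 h.zero_mem n) (tendsto_const_nhds.congr' ?_)
  filter_upwards [eventually_subset_modes {n}] with k hk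
  rw [h.initial, truncate, if_pos (mem_modes.1 (hk (Finset.mem_singleton_self n)))]

variable {t : ℝ} (ht : t ∈ Set.Icc (-lifetime R) (lifetime R))
include ht

lemma conj (n : ℤ) : u t (-n) = star (u t n) := by
  refine tendsto_nhds_unique (h.tendsto t ht (-n)) (((h.tendsto t ht n).star).congr fun k => ?_)
  rw [((h.galerkin k).trig t ht).conj]

lemma zero : u t 0 = 0 := by
  refine tendsto_nhds_unique (h.tendsto t ht 0) (tendsto_const_nhds.congr fun k => ?_)
  rw [((h.galerkin k).trig t ht).zero]

/-- Propagation of the regularity given by an admissible weight to the approximations. -/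
lemma energy_approx_le {p : ℝ} (hp : 1 ≤ p) {w : ℤ → ℝ} (hw : IsAdmissible p w)
    (hs : Summable fun n => w n * ‖x n‖ ^ 2) (k : ℕ) :
    energy (k + 1) w (V k t) ≤ (∑' n, w n * ‖x n‖ ^ 2) * growthConst p R := by
  have h1 := (h.galerkin k).energy_le (convex_Icc _ _) h.zero_mem h.radius_pos
    (fun t ht => abs_le.2 ht)
    (energy_truncate_weightTwo_le h.datum_summable h.datum_le (h.initial k)) hp hw ht
  refine h1.trans (mul_le_mul_of_nonneg_right ?_ (Real.exp_pos _).le)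
  rw [show V k 0 = truncate (k + 1) x from funext (h.initial k)]
  exact energy_truncate_le hw.nonneg hs _

/-- Propagation of the regularity given by an admissible weight. -/
lemma sum_le {p : ℝ} (hp : 1 ≤ p) {w : ℤ → ℝ} (hw : IsAdmissible p w)
    (hs : Summable fun n => w n * ‖x n‖ ^ 2) (S : Finset ℤ) :
    ∑ n ∈ S, w n * ‖u t n‖ ^ 2 ≤ (∑' n, w n * ‖x n‖ ^ 2) * growthConst p R := by
  have h1 : Tendsto (fun k => ∑ n ∈ S, w n * ‖V k t n‖ ^ 2) atTop
      (𝓝 (∑ n ∈ S, w n * ‖u t n‖ ^ 2)) :=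
    tendsto_finsetSum _ fun n _ => ((h.tendsto t ht n).norm.pow 2).const_mul _
  refine le_of_tendsto h1 ?_
  filter_upwards [eventually_subset_modes S] with k hk
  exact (Finset.sum_le_sum_of_subset_of_nonneg hk fun n _ _ =>
    mul_nonneg (hw.nonneg n) (by positivity)).trans (h.energy_approx_le ht hp hw hs k)

lemma summable {p : ℝ} (hp : 1 ≤ p) {w : ℤ → ℝ} (hw : IsAdmissible p w)
    (hs : Summable fun n => w n * ‖x n‖ ^ 2) : Summable fun n => w n * ‖u t n‖ ^ 2 :=
  summable_of_sum_le (fun n => mul_nonneg (hw.nonneg n) (by positivity))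
    (h.sum_le ht hp hw hs)

/-- The Benjamin-Ono solution is close to any Galerkin approximation with the same datum. -/
lemma sum_sq_sub_le {N : ℕ} (hN : 0 < N) {J : Set ℝ} (hJ : Convex ℝ J) (h0 : (0 : ℝ) ∈ J)
    (hJR : J ⊆ Set.Icc (-lifetime R) (lifetime R)) {v : ℝ → ℤ → ℂ} (hv : IsGalerkin N J v)
    (hv0 : ∀ n, v 0 n = truncate N x n) (htJ : t ∈ J) (S : Finset ℤ) :
    ∑ n ∈ S, ‖u t n - v t n‖ ^ 2 ≤ diffConst R / N := by
  have h1 : Tendsto (fun k => ∑ n ∈ S, ‖V k t n - v t n‖ ^ 2) atTop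
      (𝓝 (∑ n ∈ S, ‖u t n - v t n‖ ^ 2)) :=
    tendsto_finsetSum _ fun n _ => ((h.tendsto t ht n).sub_const _).norm.pow 2
  refine le_of_tendsto h1 ?_
  filter_upwards [eventually_subset_modes S, eventually_ge_atTop N] with k hk hNk
  refine (Finset.sum_le_sum_of_subset_of_nonneg hk fun n _ _ => by positivity).trans ?_
  refine sum_sq_difference_le hN (hNk.trans k.le_succ) ((h.galerkin k).mono_set hJR) hv hJ h0
    h.radius_pos (fun t ht => abs_le.2 (hJR ht))
    (energy_truncate_weightTwo_le h.datum_summable h.datum_le (h.initial k)) (fun n hn => ?_) htJ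
  rw [h.initial, hv0, truncate, truncate, if_pos hn,
    if_pos (hn.trans (by exact_mod_cast hNk.trans k.le_succ))]

lemma sqBound_sub (k : ℕ) : SqBound (√(diffConst R / (k + 1 : ℕ))) fun n => u t n - V k t n := by
  have hD : 0 ≤ diffConst R := by
    have := h.radius_pos
    unfold diffConst
    positivity
  intro S
  rw [Real.sq_sqrt (by positivity)]
  exact h.sum_sq_sub_le ht k.succ_pos (convex_Icc _ _) h.zero_mem subset_rfl (h.galerkin k)
    (h.initial k) ht S

omit ht in
lemma exists_sqBound : ∃ A : ℝ, 0 ≤ A ∧ ∀ t ∈ Set.Icc (-lifetime R) (lifetime R),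
    SqBound A (u t) ∧ ∀ k, SqBound A (V k t) := by
  have hpos : 0 ≤ (∑' n, weightTwo n * ‖x n‖ ^ 2) * growthConst 2 R :=
    mul_nonneg (tsum_nonneg fun n => mul_nonneg (isAdmissible_weightTwo.nonneg n) (by positivity))
      (Real.exp_pos _).le
  have hw : ∀ n, 1 ≤ weightTwo n := fun n => by
    rw [weightTwo_eq]; exact one_le_pow₀ (one_le_bracket n)
  refine ⟨√((∑' n, weightTwo n * ‖x n‖ ^ 2) * growthConst 2 R), Real.sqrt_nonneg _,
    fun t ht => ⟨fun S => ?_, fun k S => ?_⟩⟩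
  · rw [Real.sq_sqrt hpos]
    refine le_trans (Finset.sum_le_sum fun n _ => ?_)
      (h.sum_le ht one_le_two isAdmissible_weightTwo h.datum_summable S)
    exact le_mul_of_one_le_left (by positivity) (hw n)
  · rw [Real.sq_sqrt hpos]
    refine le_trans ?_
      (h.energy_approx_le ht one_le_two isAdmissible_weightTwo h.datum_summable k)
    calc ∑ n ∈ S, ‖V k t n‖ ^ 2 ≤ ∑ n ∈ modes (k + 1), ‖V k t n‖ ^ 2 := by
          refine (Finset.sum_le_sum_of_subset_of_nonneg
            (Finset.subset_union_left (s₂ := modes (k + 1))) fun n _ _ => by positivity).trans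
            (Finset.sum_subset Finset.subset_union_right fun n _ hn => ?_).symm.le
          rw [((h.galerkin k).trig t ht).supp n (by simpa using hn), norm_zero,
            zero_pow two_ne_zero]
      _ ≤ _ := Finset.sum_le_sum fun n _ => le_mul_of_one_le_left (by positivity) (hw n)

omit ht in
/-- The limit of the Galerkin approximations solves the Benjamin-Ono equation. -/
lemma hasDerivAt (ht : t ∈ Set.Ioo (-lifetime R) (lifetime R)) (n : ℤ) :
    HasDerivAt (fun τ => u τ n) (boField (u t) n) t := by
  obtain ⟨A, hA, hAu⟩ := h.exists_sqBound
  refine hasDerivAt_of_tendstoUniformlyOn (l := atTop) (f := fun k τ => V k τ n)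
    (f' := fun k τ => boField (V k τ) n) (g' := fun τ => boField (u τ) n) isOpen_Ioo ?_ ?_
    (fun τ hτ => h.tendsto τ (Set.Ioo_subset_Icc_self hτ) n) ht
  · have hlim : Tendsto (fun k : ℕ => ((n : ℝ) ^ 2 + |(n : ℝ)| * A) *
        √(diffConst R / (k + 1 : ℕ))) atTop (𝓝 0) := by
      rw [← mul_zero ((n : ℝ) ^ 2 + |(n : ℝ)| * A), ← Real.sqrt_zero]
      refine Tendsto.const_mul _ (Tendsto.sqrt ?_)
      exact (tendsto_const_div_atTop_nhds_zero_nat (diffConst R)).comp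
        (tendsto_add_atTop_nat 1)
    rw [Metric.tendstoUniformlyOn_iff]
    intro ε hε
    filter_upwards [hlim.eventually_lt_const hε] with k hk τ hτ
    have hτ' := Set.Ioo_subset_Icc_self hτ
    rw [dist_eq_norm]
    exact (norm_boField_sub_le hA (Real.sqrt_nonneg _) (hAu τ hτ').1 ((hAu τ hτ').2 k)
      (h.sqBound_sub hτ' k) n).trans_lt hk
  · filter_upwards [eventually_subset_modes {n}] with k hk τ hτ
    exact ((h.galerkin k).deriv τ (Set.Ioo_subset_Icc_self hτ) n
      (mem_modes.1 (hk (Finset.mem_singleton_self n)))).hasDerivAt (Icc_mem_nhds hτ.1 hτ.2)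

omit ht in
/-- Strong continuity in time with values in `H^σ`. The damped weights `tailWeight σ K` are
admissible uniformly in `K`, so that the high frequencies remain uniformly small in time. -/
lemma tendsto_tsum_sub {σ : ℝ} (hσ : 0 ≤ σ)
    (hs : Summable fun n : ℤ => (1 + (n : ℝ) ^ 2) ^ σ * ‖x n‖ ^ 2)
    (ht : t ∈ Set.Ioo (-lifetime R) (lifetime R)) :
    Tendsto (fun τ => ∑' n : ℤ, (1 + (n : ℝ) ^ 2) ^ σ * ‖u τ n - u t n‖ ^ 2) (𝓝 t) (𝓝 0) := by
  have hp : 1 ≤ σ + 1 := by linarith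
  have hle : ∀ (K : ℕ) (n : ℤ), tailWeight σ K n * ‖x n‖ ^ 2 ≤
      (1 + (n : ℝ) ^ 2) ^ σ * ‖x n‖ ^ 2 := fun K n =>
    mul_le_mul_of_nonneg_right (tailWeight_le σ K n) (by positivity)
  have hnn : ∀ (K : ℕ) (n : ℤ), 0 ≤ tailWeight σ K n := fun K =>
    (isAdmissible_tailWeight hσ K).nonneg
  have hsK : ∀ K : ℕ, Summable fun n => tailWeight σ K n * ‖x n‖ ^ 2 := fun K =>
    Summable.of_nonneg_of_le (fun n => mul_nonneg (hnn K n) (by positivity)) (hle K) hs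
  let η : ℕ → ℝ := fun K => (∑' n, tailWeight σ K n * ‖x n‖ ^ 2) * growthConst (σ + 1) R
  have hη : Tendsto η atTop (𝓝 0) := by
    have h1 : Tendsto (fun K => ∑' n, tailWeight σ K n * ‖x n‖ ^ 2) atTop
        (𝓝 (∑' _ : ℤ, (0 : ℝ))) := by
      refine tendsto_tsum_of_dominated_convergence hs (fun n => ?_)
        (Eventually.of_forall fun K n => ?_)
      · simpa using (tendsto_tailWeight σ n).mul_const (‖x n‖ ^ 2)
      · rw [Real.norm_of_nonneg (mul_nonneg (hnn K n) (by positivity))]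
        exact hle K n
    rw [tsum_zero] at h1
    simpa [η] using h1.mul_const (growthConst (σ + 1) R)
  have hbound : ∀ K : ℕ, ∀ τ ∈ Set.Icc (-lifetime R) (lifetime R),
      ∑' n : ℤ, (1 + (n : ℝ) ^ 2) ^ σ * ‖u τ n - u t n‖ ^ 2 ≤
        energy K (fun n => (1 + (n : ℝ) ^ 2) ^ σ) (fun n => u τ n - u t n) + 4 * η K := by
    intro K τ hτ
    refine Real.tsum_le_of_sum_le (fun n => by positivity) fun S => ?_
    have h1 := h.sum_le hτ hp (isAdmissible_tailWeight hσ K) (hsK K) S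
    have h2 := h.sum_le (Set.Ioo_subset_Icc_self ht) hp (isAdmissible_tailWeight hσ K) (hsK K) S
    have h3 : ∑ n ∈ S, (if n ∈ modes K then (1 + (n : ℝ) ^ 2) ^ σ * ‖u τ n - u t n‖ ^ 2 else 0) ≤
        energy K (fun n => (1 + (n : ℝ) ^ 2) ^ σ) (fun n => u τ n - u t n) := by
      rw [Finset.sum_ite_mem]
      exact Finset.sum_le_sum_of_subset_of_nonneg Finset.inter_subset_right
        fun n _ _ => by positivity
    have h4 : ∀ n ∈ S, (1 + (n : ℝ) ^ 2) ^ σ * ‖u τ n - u t n‖ ^ 2 ≤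
        (if n ∈ modes K then (1 + (n : ℝ) ^ 2) ^ σ * ‖u τ n - u t n‖ ^ 2 else 0) +
          (2 * (tailWeight σ K n * ‖u τ n‖ ^ 2) + 2 * (tailWeight σ K n * ‖u t n‖ ^ 2)) := by
      intro n _
      have p1 := mul_nonneg (hnn K n) (sq_nonneg ‖u τ n‖)
      have p2 := mul_nonneg (hnn K n) (sq_nonneg ‖u t n‖)
      split_ifs with hn
      · linarith
      · rw [tailWeight_eq (not_le.1 (fun hle => hn (mem_modes.2 hle))).le, zero_add]
        have h5 : ‖u τ n - u t n‖ ^ 2 ≤ 2 * ‖u τ n‖ ^ 2 + 2 * ‖u t n‖ ^ 2 := by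
          have := norm_sub_le (u τ n) (u t n)
          nlinarith [norm_nonneg (u τ n - u t n), sq_nonneg (‖u τ n‖ - ‖u t n‖)]
        calc _ ≤ (1 + (n : ℝ) ^ 2) ^ σ * (2 * ‖u τ n‖ ^ 2 + 2 * ‖u t n‖ ^ 2) := by gcongr
          _ = _ := by ring
    refine (Finset.sum_le_sum h4).trans ?_
    rw [Finset.sum_add_distrib, Finset.sum_add_distrib, ← Finset.mul_sum, ← Finset.mul_sum]
    simp only [η]
    linarith
  refine tendsto_order.2 ⟨fun a ha => Eventually.of_forall fun τ =>
    ha.trans_le (tsum_nonneg fun n => by positivity), fun ε hε => ?_⟩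
  obtain ⟨K, hK⟩ := (hη.eventually_lt_const (show 0 < ε / 8 by linarith)).exists
  have hcont : Tendsto (fun τ => energy K (fun n => (1 + (n : ℝ) ^ 2) ^ σ)
      (fun n => u τ n - u t n)) (𝓝 t) (𝓝 0) := by
    have h1 : Tendsto (fun τ => energy K (fun n => (1 + (n : ℝ) ^ 2) ^ σ)
        (fun n => u τ n - u t n)) (𝓝 t)
        (𝓝 (∑ n ∈ modes K, (1 + (n : ℝ) ^ 2) ^ σ * ‖u t n - u t n‖ ^ 2)) :=
      tendsto_finsetSum _ fun n _ =>
        ((((h.hasDerivAt ht n).continuousAt.tendsto).sub_const _).norm.pow 2).const_mul _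
    simpa using h1
  filter_upwards [hcont.eventually_lt_const (show 0 < ε / 2 by linarith),
    Icc_mem_nhds ht.1 ht.2] with τ h1 hτ
  linarith [hbound K τ hτ]

end IsGalerkinLimit

end Limit

/-! ### Square integrable functions and their Fourier coefficients -/

lemma coeff_eq_repr (u : L2) (n : ℤ) : coeff u n = fourierBasis.repr u n :=
  (fourierBasis_repr u n).symm

lemma coeff_injective {u v : L2} (h : ∀ n, coeff u n = coeff v n) : u = v := by
  refine fourierBasis.repr.injective (lp.ext (funext fun n => ?_))
  rw [← coeff_eq_repr, ← coeff_eq_repr, h]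

lemma coeff_sub (u v : L2) (n : ℤ) : coeff (u - v) n = coeff u n - coeff v n := by
  simp only [coeff_eq_repr, map_sub]
  rfl

lemma summable_sq_coeff (u : L2) : Summable fun n => ‖coeff u n‖ ^ 2 :=
  (hasSum_sq_fourierCoeff u).summable

/-- The function of given Fourier coefficients, which have to be square summable. -/
noncomputable def ofCoeff (x : ℤ → ℂ) : L2 := ∑' n : ℤ, x n • fourierLp (T := 2 * π) 2 n

lemma coeff_ofCoeff {x : ℤ → ℂ} (hx : Summable fun n => ‖x n‖ ^ 2) (n : ℤ) :
    coeff (ofCoeff x) n = x n := by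
  have hmem : Memℓp x 2 := memℓp_gen (by simpa using hx)
  let y : lp (fun _ : ℤ => ℂ) 2 := ⟨x, hmem⟩
  have h1 := (fourierBasis (T := 2 * π)).hasSum_repr_symm y
  rw [coe_fourierBasis] at h1
  have h2 : ofCoeff x = fourierBasis.repr.symm y := h1.tsum_eq
  rw [h2, coeff_eq_repr, LinearIsometryEquiv.apply_symm_apply]

lemma coeff_multiplier {m : ℤ → ℂ} {u : L2} (h : Summable fun n => ‖m n * coeff u n‖ ^ 2)
    (n : ℤ) : coeff (multiplier m u) n = m n * coeff u n :=
  coeff_ofCoeff h n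

lemma coeff_star (u : L2) (n : ℤ) : coeff (star u) n = star (coeff u (-n)) := by
  have h : (star u : L2) =ᵐ[AddCircle.haarAddCircle (T := 2 * π)] star (u : Torus → ℂ) :=
    Lp.coeFn_star u
  unfold coeff
  rw [fourierCoeff_congr_ae h]
  unfold fourierCoeff
  rw [Complex.star_def, ← integral_conj]
  refine integral_congr_ae (Eventually.of_forall fun x => ?_)
  simp

/-- A square integrable function is real-valued if and only if its Fourier coefficients of
opposite frequencies are conjugate. -/
lemma ae_im_eq_zero_iff (u : L2) :
    (∀ᵐ x ∂(AddCircle.haarAddCircle (T := 2 * π)), (u x).im = 0) ↔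
      ∀ n, coeff u (-n) = star (coeff u n) := by
  have hs : (star u : L2) =ᵐ[AddCircle.haarAddCircle (T := 2 * π)] star (u : Torus → ℂ) :=
    Lp.coeFn_star u
  constructor
  · intro h n
    have h1 : star u = u := by
      refine Lp.ext ?_
      filter_upwards [hs, h] with x hx hx'
      rw [hx, Pi.star_apply, Complex.star_def]
      exact Complex.conj_eq_iff_im.2 hx'
    have h2 := coeff_star u (-n)
    rwa [h1, neg_neg] at h2
  · intro h
    have h1 : star u = u := coeff_injective fun n => by rw [coeff_star, h, star_star]
    rw [h1] at hs
    filter_upwards [hs] with x hx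
    rw [Pi.star_apply, Complex.star_def] at hx
    exact Complex.conj_eq_iff_im.1 hx.symm

/-- Parseval's identity: the Fourier coefficients of a product are given by a convolution. -/
lemma coeffMul_eq_conv (u v : L2) (n : ℤ) : coeffMul u v n = conv (coeff u) (coeff v) n := by
  have hmem : MemLp (fun x : Torus => fourier n x * star (u x)) 2
      (AddCircle.haarAddCircle (T := 2 * π)) := by
    refine (Lp.memLp u).of_le ?_ (Eventually.of_forall fun x => ?_)
    · exact ((fourier n).continuous.aestronglyMeasurable).mul
        (continuous_star.comp_aestronglyMeasurable (Lp.memLp u).1)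
    · rw [norm_mul, norm_star, fourier_apply, Circle.norm_coe, one_mul]
  set f : L2 := hmem.toLp _ with hf
  have hfx := hmem.coeFn_toLp
  have hfc : ∀ b, star (coeff f b) = coeff u (n - b) := by
    intro b
    unfold coeff
    rw [hf, fourierCoeff_congr_ae hfx]
    unfold fourierCoeff
    rw [Complex.star_def, ← integral_conj]
    refine integral_congr_ae (Eventually.of_forall fun x => ?_)
    change (starRingEnd ℂ) (fourier (-b) x * (fourier n x * star (u x))) =
      fourier (-(n - b)) x * u x
    rw [show -(n - b) = b + -n by ring, fourier_add, fourier_neg, fourier_neg, map_mul, map_mul,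
      Complex.conj_conj, Complex.star_def, Complex.conj_conj]
    ring
  have h1 : coeffMul u v n = inner ℂ f v := by
    rw [L2.inner_def]
    unfold coeffMul fourierCoeff
    refine integral_congr_ae ?_
    filter_upwards [hfx] with x hx
    rw [hf, hx, RCLike.inner_apply, Complex.star_def, map_mul, Complex.conj_conj, fourier_neg,
      smul_eq_mul]
    ring
  have h2 : inner ℂ f v = ∑' b, star (coeff f b) * coeff v b := by
    rw [← (fourierBasis (T := 2 * π)).tsum_inner_mul_inner f v]
    refine tsum_congr fun b => ?_
    rw [coeff_eq_repr, coeff_eq_repr, HilbertBasis.repr_apply_apply,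
      HilbertBasis.repr_apply_apply, Complex.star_def, inner_conj_symm]
  rw [h1, h2]
  unfold conv
  rw [← (Equiv.subLeft n).tsum_eq]
  refine tsum_congr fun b => ?_
  rw [hfc]
  simp

lemma sqBound_of_summable {f : ℤ → ℂ} (hf : Summable fun n => ‖f n‖ ^ 2) :
    SqBound (√(∑' n, ‖f n‖ ^ 2)) f := fun S => by
  rw [Real.sq_sqrt (tsum_nonneg fun n => by positivity)]
  exact hf.sum_le_tsum _ fun n _ => by positivity

/-- Fourier coefficients of the nonlinearity, in conservation form `∂ₓ(u²) / 2`. -/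
lemma conv_derivative {f : ℤ → ℂ} (hf : Summable fun n => ‖f n‖ ^ 2)
    (hf' : Summable fun n : ℤ => ‖Complex.I * n * f n‖ ^ 2) (n : ℤ) :
    conv f (fun k => Complex.I * k * f k) n = Complex.I * n / 2 * conv f f n := by
  have b := sqBound_of_summable hf
  have b' := sqBound_of_summable hf'
  have s1 := summable_mul_shift (Real.sqrt_nonneg _) (Real.sqrt_nonneg _) b b' n
  have s2 := summable_mul_shift (Real.sqrt_nonneg _) (Real.sqrt_nonneg _) b' b n
  have e : conv f (fun k => Complex.I * k * f k) n =
      ∑' c, Complex.I * c * f c * f (n - c) := by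
    unfold conv
    rw [← (Equiv.subLeft n).tsum_eq]
    refine tsum_congr fun c => ?_
    simp only [Equiv.subLeft_apply, sub_sub_cancel]
    ring
  have h2 : 2 * conv f (fun k => Complex.I * k * f k) n = Complex.I * n * conv f f n := by
    rw [two_mul]
    nth_rewrite 2 [e]
    unfold conv
    rw [← s1.tsum_add s2, ← tsum_mul_left]
    refine tsum_congr fun c => ?_
    push_cast
    ring
  linear_combination h2 / 2

lemma weightTwo_le {σ : ℝ} (hσ : 2 ≤ σ) (n : ℤ) : weightTwo n ≤ (1 + (n : ℝ) ^ 2) ^ σ :=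
  Real.rpow_le_rpow_of_exponent_le (one_le_bracket n) hσ

section Equation

variable {u : L2} (hu : Summable fun n => weightTwo n * ‖coeff u n‖ ^ 2)
include hu

lemma summable_sq_mul_coeff {m : ℤ → ℂ} (hm : ∀ n, ‖m n‖ ≤ 1 + (n : ℝ) ^ 2) :
    Summable fun n => ‖m n * coeff u n‖ ^ 2 := by
  refine Summable.of_nonneg_of_le (fun n => by positivity) (fun n => ?_) hu
  rw [norm_mul, mul_pow, weightTwo_eq]
  have := hm n
  gcongr

lemma coeff_dx (n : ℤ) : coeff (dx u) n = Complex.I * n * coeff u n := by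
  refine coeff_multiplier (summable_sq_mul_coeff hu fun n => ?_) n
  rw [norm_mul, Complex.norm_I, one_mul, Complex.norm_intCast]
  nlinarith [sq_abs (n : ℝ), abs_nonneg (n : ℝ), sq_nonneg (|(n : ℝ)| - 1)]

lemma coeff_dx_dx (n : ℤ) : coeff (dx (dx u)) n = -(n : ℂ) ^ 2 * coeff u n := by
  have h : ∀ n : ℤ, Complex.I * n * coeff (dx u) n = -(n : ℂ) ^ 2 * coeff u n := fun n => by
    rw [coeff_dx hu]
    linear_combination (n : ℂ) ^ 2 * coeff u n * Complex.I_sq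
  have hs : Summable fun n : ℤ => ‖Complex.I * n * coeff (dx u) n‖ ^ 2 := by
    simp only [h]
    refine summable_sq_mul_coeff hu fun n => ?_
    rw [norm_neg, norm_pow, Complex.norm_intCast, sq_abs]
    linarith
  exact (coeff_multiplier hs n).trans (h n)

lemma coeff_hilbert_dx_dx (n : ℤ) :
    coeff (hilbert (dx (dx u))) n = Complex.I * (Int.sign n : ℂ) * (n : ℂ) ^ 2 * coeff u n := by
  have h : ∀ n : ℤ, -Complex.I * (Int.sign n : ℂ) * coeff (dx (dx u)) n =
      Complex.I * (Int.sign n : ℂ) * (n : ℂ) ^ 2 * coeff u n := fun n => by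
    rw [coeff_dx_dx hu]
    ring
  have hs : Summable fun n : ℤ => ‖-Complex.I * (Int.sign n : ℂ) * coeff (dx (dx u)) n‖ ^ 2 := by
    simp only [h]
    refine summable_sq_mul_coeff hu fun n => ?_
    have hs : |((Int.sign n : ℤ) : ℝ)| ≤ 1 := abs_sign_le_one n
    rw [norm_mul, norm_mul, norm_pow, Complex.norm_I, one_mul, Complex.norm_intCast,
      Complex.norm_intCast, sq_abs]
    nlinarith [sq_nonneg (n : ℝ)]
  exact (coeff_multiplier hs n).trans (h n)

lemma coeffMul_dx (n : ℤ) :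
    coeffMul u (dx u) n = Complex.I * n / 2 * conv (coeff u) (coeff u) n := by
  rw [coeffMul_eq_conv, show coeff (dx u) = fun k : ℤ => Complex.I * k * coeff u k from
    funext (coeff_dx hu)]
  refine conv_derivative (summable_sq_coeff u) ?_ n
  simp only [← coeff_dx hu]
  exact summable_sq_coeff _

/-- The right-hand side of the Benjamin-Ono equation. -/
lemma rhs_eq_boField (n : ℤ) :
    -coeff (hilbert (dx (dx u))) n - coeffMul u (dx u) n = boField (coeff u) n := by
  rw [coeff_hilbert_dx_dx hu, coeffMul_dx hu, boField]

omit hu in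
lemma coeff_proj (N : ℕ) (u : L2) (n : ℤ) : coeff (proj N u) n = truncate N (coeff u) n := by
  have h : ∀ n, projSymbol N n * coeff u n = truncate N (coeff u) n := fun n => by
    unfold projSymbol truncate
    split_ifs <;> simp
  refine (coeff_multiplier ?_ n).trans (h n)
  refine Summable.of_nonneg_of_le (fun n => by positivity) (fun n => ?_) (summable_sq_coeff u)
  unfold projSymbol
  split_ifs <;> simp

/-- The low frequencies of the right-hand side of the truncated equation. -/
lemma truncated_rhs_eq_boField {N : ℕ} {n : ℤ} (hn : |n| ≤ N) :
    -coeff (hilbert (dx (dx u))) n - projSymbol N n * coeffMul (proj N u) (dx (proj N u)) n =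
      boField (truncate N (coeff u)) n := by
  have hp : Summable fun n => weightTwo n * ‖coeff (proj N u) n‖ ^ 2 := by
    refine Summable.of_nonneg_of_le (fun n => mul_nonneg (isAdmissible_weightTwo.nonneg n)
      (by positivity)) (fun n => ?_) hu
    refine mul_le_mul_of_nonneg_left ?_ (isAdmissible_weightTwo.nonneg n)
    rw [coeff_proj, truncate]
    split_ifs <;> simp
  rw [coeff_hilbert_dx_dx hu, coeffMul_dx hp, projSymbol, if_pos hn, one_mul, boField,
    show coeff (proj N u) = truncate N (coeff u) from funext (coeff_proj N u)]
  congr 3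
  rw [truncate, if_pos hn]

end Equation

/-! ### Solutions of the truncated equation -/

section Truncated

variable {N : ℕ} {σ : ℝ} {J : Set ℝ} {U : ℝ → L2}

lemma summable_weightTwo_of_mem_Hs {ρ : ℝ} (hρ : 2 ≤ ρ) {f : L2} (hf : f ∈ Hs ρ) :
    Summable fun n => weightTwo n * ‖coeff f n‖ ^ 2 :=
  Summable.of_nonneg_of_le
    (fun n => mul_nonneg (isAdmissible_weightTwo.nonneg n) (by positivity))
    (fun n => mul_le_mul_of_nonneg_right (weightTwo_le hρ n) (by positivity)) hf.2.2

/-- The low frequencies of a solution of the truncated equation are a Galerkin approximation. -/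
lemma SolvesTruncatedBO.isGalerkin (hσ : 2 ≤ σ) (hU : SolvesTruncatedBO N σ J U) :
    IsGalerkin N J fun τ => truncate N (coeff (U τ)) where
  trig t ht := by
    obtain ⟨h1, h2, -⟩ := (hU.1 t ht).1
    exact isRealTrig_truncate ((ae_im_eq_zero_iff _).1 h1) h2 N
  deriv t ht n hn := by
    have h := hU.2 t ht n
    rw [truncated_rhs_eq_boField (summable_weightTwo_of_mem_Hs hσ (hU.1 t ht).1) hn] at h
    simpa only [truncate, if_pos hn] using h

/-- The high frequencies of a solution of the truncated equation evolve linearly. -/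
lemma SolvesTruncatedBO.norm_coeff_eq (hσ : 2 ≤ σ) (hU : SolvesTruncatedBO N σ J U)
    (hJ : Convex ℝ J) {n : ℤ} (hn : ¬ |n| ≤ (N : ℤ)) {s t : ℝ} (hs : s ∈ J) (ht : t ∈ J) :
    ‖coeff (U t) n‖ = ‖coeff (U s) n‖ := by
  have hd : ∀ τ ∈ J, HasDerivWithinAt (fun τ => ‖coeff (U τ) n‖ ^ 2) 0 J τ := by
    intro τ hτ
    have h := hU.2 τ hτ n
    rw [coeff_hilbert_dx_dx (summable_weightTwo_of_mem_Hs hσ (hU.1 τ hτ).1), projSymbol,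
      if_neg hn, zero_mul, sub_zero] at h
    have h1 := h.norm_sq
    rw [Complex.inner] at h1
    convert h1 using 1
    have e : -(Complex.I * (Int.sign n : ℂ) * (n : ℂ) ^ 2 * coeff (U τ) n) *
        (starRingEnd ℂ) (coeff (U τ) n) =
        -(((Int.sign n * n ^ 2 * Complex.normSq (coeff (U τ) n) : ℝ) : ℂ) * Complex.I) := by
      push_cast
      rw [Complex.normSq_eq_conj_mul_self]
      ring
    rw [e, Complex.neg_re, Complex.re_ofReal_mul, Complex.I_re]
    simp
  have h := hJ.norm_image_sub_le_of_norm_hasDerivWithin_le (C := 0) hd (fun _ _ => by simp) hs ht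
  rw [zero_mul] at h
  have h' := sub_eq_zero.1 (norm_le_zero_iff.1 h)
  exact (pow_left_inj₀ (norm_nonneg _) (norm_nonneg _) two_ne_zero).1 h'

end Truncated

/-! ### Solutions of the Benjamin-Ono equation -/

/-- Local existence for the Benjamin-Ono equation, in the form of the convergence of the Galerkin
approximations. -/
lemma IsGalerkinLimit.solvesBO {x : ℤ → ℂ} {R : ℝ} {V : ℕ → ℝ → ℤ → ℂ} {u : ℝ → ℤ → ℂ}
    (h : IsGalerkinLimit x R V u) {σ : ℝ} (hσ : 2 ≤ σ)
    (hs : Summable fun n : ℤ => (1 + (n : ℝ) ^ 2) ^ σ * ‖x n‖ ^ 2) {J : Set ℝ}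
    (hJ : J ⊆ Set.Ioo (-lifetime R) (lifetime R)) :
    SolvesBO σ J (fun t => ofCoeff (u t)) := by
  have hadm := isAdmissible_bracket (p := σ) (by linarith)
  have hσ1 : 1 ≤ σ := by linarith
  have hc : ∀ t ∈ Set.Ioo (-lifetime R) (lifetime R), ∀ n, coeff (ofCoeff (u t)) n = u t n := by
    intro t ht n
    refine coeff_ofCoeff ?_ n
    refine Summable.of_nonneg_of_le (fun n => by positivity) (fun n => ?_)
      (h.summable (Set.Ioo_subset_Icc_self ht) hσ1 hadm hs)
    exact le_mul_of_one_le_left (by positivity)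
      (Real.one_le_rpow (one_le_bracket n) (by linarith))
  have hHs : ∀ t ∈ Set.Ioo (-lifetime R) (lifetime R), ofCoeff (u t) ∈ Hs σ := by
    intro t ht
    have ht' := Set.Ioo_subset_Icc_self ht
    refine ⟨(ae_im_eq_zero_iff _).2 fun n => ?_, ?_, ?_⟩
    · rw [hc t ht, hc t ht, h.conj ht']
    · rw [hc t ht, h.zero ht']
    · simpa only [hc t ht] using h.summable ht' hσ1 hadm hs
  refine ⟨fun t htJ => ⟨hHs t (hJ htJ), ?_⟩, fun t htJ n => ?_⟩
  · have ht := hJ htJ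
    refine Tendsto.mono_left ?_ nhdsWithin_le_nhds
    have h1 := (h.tendsto_tsum_sub (by linarith) hs ht).sqrt
    rw [Real.sqrt_zero] at h1
    refine h1.congr' ?_
    filter_upwards [isOpen_Ioo.mem_nhds ht] with τ hτ
    unfold sobolevNorm
    simp only [coeff_sub, hc τ hτ, hc t ht]
  · have ht := hJ htJ
    rw [rhs_eq_boField (summable_weightTwo_of_mem_Hs hσ (hHs t ht)),
      show coeff (ofCoeff (u t)) = u t from funext (hc t ht)]
    refine ((h.hasDerivAt ht n).congr_of_eventuallyEq ?_).hasDerivWithinAt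
    filter_upwards [isOpen_Ioo.mem_nhds ht] with τ hτ
    exact hc τ hτ n

/-! ### Comparison of the two flows -/

/-- Interpolation between `L²` and `H^σ`. -/
lemma exists_rpow_le_add {s σ δ : ℝ} (hs : 0 ≤ s) (hsσ : s < σ) (hδ : 0 < δ) :
    ∃ K : ℝ, 0 < K ∧ ∀ n : ℤ, (1 + (n : ℝ) ^ 2) ^ s ≤ K + δ * (1 + (n : ℝ) ^ 2) ^ σ := by
  have h := (tendsto_rpow_neg_atTop (sub_pos.2 hsσ)).eventually_le_const hδ
  obtain ⟨X, hX⟩ := eventually_atTop.1 h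
  refine ⟨(max X 1) ^ s, by positivity, fun n => ?_⟩
  have hn := bracket_pos n
  rcases le_total X (1 + (n : ℝ) ^ 2) with h1 | h1
  · have h2 := hX _ h1
    have h3 : (1 + (n : ℝ) ^ 2) ^ s =
        (1 + (n : ℝ) ^ 2) ^ (-(σ - s)) * (1 + (n : ℝ) ^ 2) ^ σ := by
      rw [← Real.rpow_add hn]; congr 1; ring
    rw [h3]
    have h4 := mul_le_mul_of_nonneg_right h2 (Real.rpow_nonneg hn.le σ)
    have h5 : 0 ≤ (max X 1) ^ s := by positivity
    linarith
  · have h2 : (1 + (n : ℝ) ^ 2) ^ s ≤ (max X 1) ^ s :=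
      Real.rpow_le_rpow hn.le (h1.trans (le_max_left _ _)) hs
    have h3 : 0 ≤ δ * (1 + (n : ℝ) ^ 2) ^ σ := by positivity
    linarith

lemma tsum_le_sq_of_sobolevNorm_lt {ρ r : ℝ} {f : L2} (h : sobolevNorm ρ f < r) :
    ∑' n : ℤ, (1 + (n : ℝ) ^ 2) ^ ρ * ‖coeff f n‖ ^ 2 ≤ r ^ 2 :=
  (Real.sqrt_le_left ((Real.sqrt_nonneg _).trans h.le)).1 h.le

/-- The constant in the `H^σ` estimate of the difference of the two flows. -/
noncomputable def regularityConst (σ R : ℝ) : ℝ := 2 * R ^ 2 + 8 * (R ^ 2 * growthConst σ R)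

/-- The two flows, with the same datum in the ball of radius `R` of `H^σ`, differ in `L²` by
`O(N^{-1/2})`, while their difference remains bounded in `H^σ`. -/
lemma IsGalerkinLimit.sum_sub_truncated_le {R : ℝ} {V : ℕ → ℝ → ℤ → ℂ} {u : ℝ → ℤ → ℂ}
    {N : ℕ} (hN : 0 < N) {σ : ℝ} (hσ : 2 ≤ σ) {J : Set ℝ} (hJ : Convex ℝ J) (h0 : (0 : ℝ) ∈ J)
    (hJR : J ⊆ Set.Icc (-lifetime R) (lifetime R)) {U : ℝ → L2}
    (hU : SolvesTruncatedBO N σ J U) (h : IsGalerkinLimit (coeff (U 0)) R V u)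
    (hU0 : ∑' n : ℤ, (1 + (n : ℝ) ^ 2) ^ σ * ‖coeff (U 0) n‖ ^ 2 ≤ R ^ 2)
    {t : ℝ} (ht : t ∈ J) (S : Finset ℤ) :
    ∑ n ∈ S, ‖coeff (U t) n - u t n‖ ^ 2 ≤ 2 * (R ^ 2 + diffConst R) / N ∧
    ∑ n ∈ S, (1 + (n : ℝ) ^ 2) ^ σ * ‖coeff (U t) n - u t n‖ ^ 2 ≤ regularityConst σ R := by
  have hN0 : (0 : ℝ) < N := by exact_mod_cast hN
  have hR := h.radius_pos
  have hadm := isAdmissible_bracket (p := σ) (by linarith)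
  have hs := (hU.1 0 h0).1.2.2
  have hv := hU.isGalerkin hσ
  set v : ℝ → ℤ → ℂ := fun τ => truncate N (coeff (U τ)) with hvdef
  have hv0 : energy N weightTwo (v 0) ≤ R ^ 2 :=
    energy_truncate_weightTwo_le h.datum_summable h.datum_le fun n => rfl
  -- the high frequencies
  have hhigh : ∀ n, ‖coeff (U t) n - v t n‖ ≤ ‖coeff (U 0) n‖ ∧
      (|n| ≤ (N : ℤ) → ‖coeff (U t) n - v t n‖ = 0) := by
    intro n
    by_cases hn : |n| ≤ (N : ℤ)
    · have : ‖coeff (U t) n - v t n‖ = 0 := by simp [hvdef, truncate, hn]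
      exact ⟨this.le.trans (norm_nonneg _), fun _ => this⟩
    · refine ⟨?_, fun h => absurd h hn⟩
      have : v t n = 0 := by simp [hvdef, truncate, hn]
      rw [this, sub_zero, hU.norm_coeff_eq hσ hJ hn h0 ht]
  have hsum0 : ∑ n ∈ S, (1 + (n : ℝ) ^ 2) ^ σ * ‖coeff (U 0) n‖ ^ 2 ≤ R ^ 2 :=
    (hs.sum_le_tsum _ fun n _ => by positivity).trans hU0
  have hH : ∑ n ∈ S, (1 + (n : ℝ) ^ 2) ^ σ * ‖coeff (U t) n - v t n‖ ^ 2 ≤ R ^ 2 := by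
    refine (Finset.sum_le_sum fun n _ => ?_).trans hsum0
    have := (hhigh n).1
    gcongr
  have hL : ∑ n ∈ S, ‖coeff (U t) n - v t n‖ ^ 2 ≤ R ^ 2 / N := by
    rw [le_div_iff₀ hN0, Finset.sum_mul]
    refine (Finset.sum_le_sum fun n _ => ?_).trans hH
    by_cases hn : |n| ≤ (N : ℤ)
    · rw [(hhigh n).2 hn]; simp
    · rw [mul_comm]
      refine mul_le_mul_of_nonneg_right ?_ (by positivity)
      refine le_trans ?_ (weightTwo_le hσ n)
      rw [weightTwo_eq]
      have hn' : (N : ℝ) ≤ |(n : ℝ)| := by exact_mod_cast (not_le.1 hn).le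
      calc (N : ℝ) ≤ 1 + (n : ℝ) ^ 2 := by
            nlinarith [sq_abs (n : ℝ), sq_nonneg (|(n : ℝ)| - 1)]
        _ ≤ (1 + (n : ℝ) ^ 2) ^ 2 := le_self_pow₀ (one_le_bracket n) two_ne_zero
  -- the low frequencies
  have hL' := h.sum_sq_sub_le (hJR ht) hN hJ h0 hJR hv (fun n => rfl) ht S
  have hu := h.sum_le (hJR ht) (by linarith : 1 ≤ σ) hadm hs S
  have hG : 0 < growthConst σ R := Real.exp_pos _
  have hvσ : ∑ n ∈ S, (1 + (n : ℝ) ^ 2) ^ σ * ‖v t n‖ ^ 2 ≤ R ^ 2 * growthConst σ R := by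
    have h1 := hv.energy_le hJ h0 hR (fun t ht => abs_le.2 (hJR ht)) hv0 (by linarith : 1 ≤ σ)
      hadm ht
    have h2 := energy_truncate_le hadm.nonneg hs N
    calc ∑ n ∈ S, (1 + (n : ℝ) ^ 2) ^ σ * ‖v t n‖ ^ 2
        ≤ ∑ n ∈ S ∪ modes N, (1 + (n : ℝ) ^ 2) ^ σ * ‖v t n‖ ^ 2 :=
          Finset.sum_le_sum_of_subset_of_nonneg Finset.subset_union_left
            fun n _ _ => by positivity
      _ = energy N (fun n : ℤ => (1 + (n : ℝ) ^ 2) ^ σ) (v t) :=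
          (Finset.sum_subset Finset.subset_union_right fun n _ hn => by
            rw [(hv.trig t ht).supp n (by simpa using hn), norm_zero, zero_pow two_ne_zero,
              mul_zero]).symm
      _ ≤ _ := h1.trans (mul_le_mul_of_nonneg_right (h2.trans hU0) hG.le)
  have huσ : ∑ n ∈ S, (1 + (n : ℝ) ^ 2) ^ σ * ‖u t n‖ ^ 2 ≤ R ^ 2 * growthConst σ R :=
    hu.trans (mul_le_mul_of_nonneg_right hU0 hG.le)
  have two : ∀ a b : ℂ, ‖a + b‖ ^ 2 ≤ 2 * ‖a‖ ^ 2 + 2 * ‖b‖ ^ 2 := fun a b => by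
    have := norm_add_le a b
    nlinarith [norm_nonneg (a + b), sq_nonneg (‖a‖ - ‖b‖)]
  have hsplit : ∀ n, ‖coeff (U t) n - u t n‖ ^ 2 ≤
      2 * ‖coeff (U t) n - v t n‖ ^ 2 + 2 * ‖u t n - v t n‖ ^ 2 := fun n => by
    have := two (coeff (U t) n - v t n) (v t n - u t n)
    rwa [sub_add_sub_cancel, norm_sub_rev (v t n)] at this
  constructor
  · calc _ ≤ ∑ n ∈ S, (2 * ‖coeff (U t) n - v t n‖ ^ 2 + 2 * ‖u t n - v t n‖ ^ 2) :=
          Finset.sum_le_sum fun n _ => hsplit n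
      _ ≤ 2 * (R ^ 2 / N) + 2 * (diffConst R / N) := by
          rw [Finset.sum_add_distrib, ← Finset.mul_sum, ← Finset.mul_sum]
          linarith
      _ = _ := by ring
  · calc _ ≤ ∑ n ∈ S, (2 * ((1 + (n : ℝ) ^ 2) ^ σ * ‖coeff (U t) n - v t n‖ ^ 2) +
          (4 * ((1 + (n : ℝ) ^ 2) ^ σ * ‖u t n‖ ^ 2) +
            4 * ((1 + (n : ℝ) ^ 2) ^ σ * ‖v t n‖ ^ 2))) :=
          Finset.sum_le_sum fun n _ => by
            have h1 := two (u t n) (-v t n)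
            rw [← sub_eq_add_neg, norm_neg] at h1
            calc (1 + (n : ℝ) ^ 2) ^ σ * ‖coeff (U t) n - u t n‖ ^ 2
                ≤ (1 + (n : ℝ) ^ 2) ^ σ * (2 * ‖coeff (U t) n - v t n‖ ^ 2 +
                  2 * (2 * ‖u t n‖ ^ 2 + 2 * ‖v t n‖ ^ 2)) := by
                  gcongr
                  linarith [hsplit n]
              _ = _ := by ring
      _ ≤ _ := by
          rw [Finset.sum_add_distrib, Finset.sum_add_distrib, ← Finset.mul_sum,
            ← Finset.mul_sum, ← Finset.mul_sum, regularityConst]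
          linarith

/-- Convergence of the flows in `H^s`, uniformly for data in the ball of radius `R` of `H^σ`. -/
lemma exists_truncatedFlowImage_subset {R : ℝ} (hR : 0 < R) {s σ : ℝ} (hs : 2 ≤ s) (hsσ : s < σ)
    {ε : ℝ} (hε : 0 < ε) : ∃ N₀ : ℕ, ∀ N : ℕ, N₀ < N → ∀ t : ℝ, |t| < lifetime R →
      ∀ A ⊆ sobolevBall σ R,
        truncatedFlowImage N σ t A ⊆ flowImage σ t A + sobolevBall s ε := by
  have hσ : 2 ≤ σ := hs.trans hsσ.le
  have hD : 0 < diffConst R := by unfold diffConst; positivity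
  have hG : 0 < growthConst σ R := Real.exp_pos _
  have hC : 0 < regularityConst σ R := by unfold regularityConst; positivity
  obtain ⟨K, hK, hKn⟩ := exists_rpow_le_add (s := s) (σ := σ) (by linarith) hsσ
    (show 0 < ε ^ 2 / (4 * regularityConst σ R) by positivity)
  obtain ⟨N₀, hN₀⟩ := exists_nat_gt (4 * K * (2 * (R ^ 2 + diffConst R)) / ε ^ 2)
  refine ⟨N₀, fun N hN t ht A hA f => ?_⟩
  rintro ⟨U, hU, hU0, rfl⟩
  have hNpos : 0 < N := by omega
  have hN0 : (0 : ℝ) < N := by exact_mod_cast hNpos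
  have hJ : Convex ℝ (Set.uIcc 0 t) := convex_uIcc 0 t
  have h0 : (0 : ℝ) ∈ Set.uIcc 0 t := Set.left_mem_uIcc
  have hmem : t ∈ Set.uIcc 0 t := Set.right_mem_uIcc
  have hJR : Set.uIcc 0 t ⊆ Set.Ioo (-lifetime R) (lifetime R) := fun τ hτ => by
    have := Set.abs_sub_left_of_mem_uIcc hτ
    rw [sub_zero, sub_zero] at this
    exact abs_lt.1 (this.trans_lt ht)
  obtain ⟨⟨hreal, hzero, hsum⟩, hlt⟩ := hA hU0
  have hle := tsum_le_sq_of_sobolevNorm_lt hlt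
  have hsum2 := summable_weightTwo_of_mem_Hs hσ (hU.1 0 h0).1
  have hle2 : ∑' n, weightTwo n * ‖coeff (U 0) n‖ ^ 2 ≤ R ^ 2 := by
    refine (Summable.tsum_le_tsum (fun n => ?_) hsum2 hsum).trans hle
    exact mul_le_mul_of_nonneg_right (weightTwo_le hσ n) (by positivity)
  obtain ⟨V, u, h⟩ := exists_isGalerkinLimit hR ((ae_im_eq_zero_iff _).1 hreal) hzero hsum2 hle2
  have hBO := h.solvesBO hσ hsum hJR
  have hinit : ofCoeff (u 0) = U 0 := by
    refine coeff_injective fun n => ?_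
    rw [show u 0 = coeff (U 0) from funext h.initial_eq]
    exact coeff_ofCoeff (summable_sq_coeff _) n
  refine Set.mem_add.2 ⟨ofCoeff (u t), ⟨_, hBO, by rwa [hinit], rfl⟩, U t - ofCoeff (u t), ?_,
    add_sub_cancel _ _⟩
  have hcu : ∀ n, coeff (ofCoeff (u t)) n = u t n := by
    refine coeff_ofCoeff (Summable.of_nonneg_of_le (fun n => by positivity) (fun n => ?_)
      (h.summable (Set.Ioo_subset_Icc_self (hJR hmem)) one_le_two isAdmissible_weightTwo hsum2))
    exact le_mul_of_one_le_left (by positivity)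
      (by rw [weightTwo_eq]; exact one_le_pow₀ (one_le_bracket n))
  have hbound : ∀ S : Finset ℤ, ∑ n ∈ S, (1 + (n : ℝ) ^ 2) ^ s *
      ‖coeff (U t - ofCoeff (u t)) n‖ ^ 2 ≤ ε ^ 2 / 2 := by
    intro S
    simp only [coeff_sub, hcu]
    obtain ⟨b1, b2⟩ := h.sum_sub_truncated_le hNpos hσ hJ h0
      (hJR.trans Set.Ioo_subset_Icc_self) hU hle hmem S
    calc _ ≤ ∑ n ∈ S, (K * ‖coeff (U t) n - u t n‖ ^ 2 + ε ^ 2 / (4 * regularityConst σ R) *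
          ((1 + (n : ℝ) ^ 2) ^ σ * ‖coeff (U t) n - u t n‖ ^ 2)) :=
          Finset.sum_le_sum fun n _ => by
            have := mul_le_mul_of_nonneg_right (hKn n) (sq_nonneg ‖coeff (U t) n - u t n‖)
            linarith
      _ ≤ K * (2 * (R ^ 2 + diffConst R) / N) +
          ε ^ 2 / (4 * regularityConst σ R) * regularityConst σ R := by
          rw [Finset.sum_add_distrib, ← Finset.mul_sum, ← Finset.mul_sum]
          gcongr
      _ ≤ ε ^ 2 / 4 + ε ^ 2 / 4 := by
          refine add_le_add ?_ (le_of_eq ?_)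
          · have h1 : 4 * K * (2 * (R ^ 2 + diffConst R)) / ε ^ 2 < N :=
              hN₀.trans (by exact_mod_cast hN)
            rw [div_lt_iff₀ (by positivity)] at h1
            rw [← mul_div_assoc, div_le_iff₀ hN0]
            linarith
          · field_simp
      _ = _ := by ring
  obtain ⟨r1, r2, -⟩ := (hU.1 t hmem).1
  obtain ⟨r3, r4, -⟩ := (hBO.1 t hmem).1
  rw [ae_im_eq_zero_iff] at r1 r3
  refine ⟨⟨(ae_im_eq_zero_iff _).2 fun n => ?_, ?_,
    summable_of_sum_le (fun n => by positivity) hbound⟩, ?_⟩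
  · rw [coeff_sub, coeff_sub, r1, r3, star_sub]
  · rw [coeff_sub, r2, r4, sub_zero]
  · rw [sobolevNorm, Real.sqrt_lt' hε]
    refine (Real.tsum_le_of_sum_le (fun n => by positivity) hbound).trans_lt ?_
    have : 0 < ε ^ 2 := by positivity
    linarith

end BenjaminOno

theorem proposition4p1 (R : ℝ) (hR : 0 < R) :
    ∃ tbar : ℝ, 0 < tbar ∧
      ∀ s σ : ℝ, 2 ≤ s → s < σ →
        ∀ ε : ℝ, 0 < ε → ∃ N₀ : ℕ, ∀ N : ℕ, N₀ < N → ∀ t : ℝ, |t| < tbar →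
          ∀ A : Set BenjaminOno.L2, A ⊆ BenjaminOno.sobolevBall σ R →
            BenjaminOno.truncatedFlowImage N σ t A ⊆
              BenjaminOno.flowImage σ t A + BenjaminOno.sobolevBall s ε :=
  ⟨BenjaminOno.lifetime R, BenjaminOno.lifetime_pos hR, fun _ _ hs hsσ _ hε =>
    BenjaminOno.exists_truncatedFlowImage_subset hR hs hsσ hε⟩
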